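/- Let $W=\{W(t,A)\}$, indexed by $t\ge 0$ and bounded Borel sets $A\subset\mathbb R$, be a space-time white noise, i.e. a centered Gaussian family with $\mathbb E[W(t,A)W(t',A')]=(t\wedge t')\,|A\cap A'|$, where $|\cdot|$ is Lebesgue measure. Let $T\ge 1$ and let $$u(t,x)=\int_0^t\int_{\mathbb R}G(t-s,x-y)\,dW(s,y),\qquad t\in[0,T],\ x\in\mathbb R,$$ (Wiener integral), with $G(t,x)=(2\pi t)^{-1/2}e^{-|x|^2/(2t)}$ for $t>0$ and $G(t,x)=0$ for $t\le 0$, be the mild solution of $\partial_t u=\tfrac12\Delta u+\partial_t\partial_x W$, $u(0,\cdot)=0$. Fix $x\in\mathbb R$ and take a version of $u$ for which $(t,\omega)\mapsto u(t,x)(\omega)$ is measurable (possibly after changing it on a null set for $dt\otimes\mathbb P$) on $[0,T]\times\Omega$. A jointly continuous local time of the path $u(\cdot,x)$ is a continuous function $(\xi,t)\mapsto L(\xi,t)\ge 0$ on $\mathbb R\times[0,T]$ such that $|\{s\in[0,t]:u(s,x)\in A\}|=\int_A L(\xi,t)\,d\xi$ for all $t\in[0,T]$ and all Borel sets $A\subset\mathbb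 R$. (For a given path there is at most one.) For $\lambda>0$ put $\omega_\lambda(t)=t^{3/4}(\log(1/t))^{\lambda}$, $0<t<1$. For $0<p<\infty$, let $\mathcal B^{\omega_\lambda}_p$ be the set of all $f\in L^p([0,1])$ such that, for one (equivalently, every) $t_0\in(0,1)$, $$\|f\|_{L^p([0,1])}+\sup_{0<t\le t_0}\frac{\Delta_p(f)(t)}{\omega_\lambda(t)}<\infty,\qquad \Delta_p(f)(t)=\sup_{|s|\le t}\Big\{\int_{\{r\in[0,1]:\,r+s\in[0,1]\}}|f(r+s)-f(r)|^p\,dr\Big\}^{1/p}.$$ Then for all $\lambda>0$, $p>1/\lambda$ and $\xi\in\mathbb R$, almost surely the path $u(\cdot,x)$ has a jointly continuous local time $L$ on $[0,T]$, and the function $t\mapsto L(\xi,t)$, $t\in[0,1]$, belongs to $\mathcal B^{\omega_\lambda}_p$. -/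

import Mathlib

open MeasureTheory ProbabilityTheory Set Filter Topology
open scoped NNReal ENNReal

namespace StochasticHeat

/-! ### Space-time white noise and the Wiener integral -/

/-- The bounded Borel subsets of the real line. -/
abbrev BoundedBorel : Type := {A : Set ℝ // MeasurableSet A ∧ Bornology.IsBounded A}

/-- `W` is a space-time white noise on the half line `[0, ∞)` times `ℝ`: a centered Gaussian family
`W (t, A)`, with `t ≥ 0` and `A` a bounded Borel set, such that
`E[W (t, A) W (t', A')] = min t t' * |A ∩ A'|`. -/
structure IsWhiteNoise {Ω : Type*} [MeasurableSpace Ω] (P : Measure Ω)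
    (W : ℝ≥0 × BoundedBorel → Ω → ℝ) : Prop where
  gaussian : IsGaussianProcess W P
  centered : ∀ i, ∫ ω, W i ω ∂P = 0
  covariance : ∀ (t t' : ℝ≥0) (A A' : BoundedBorel),
    ∫ ω, W (t, A) ω * W (t', A') ω ∂P = min (t : ℝ) t' * volume.real (A.1 ∩ A'.1)

/-- The elementary function `∑ a * 1_{(0, t] × A}`, where `c` has the coefficient `a` at `(t, A)`. -/
noncomputable def stepFunction (c : ℝ≥0 × BoundedBorel →₀ ℝ) (z : ℝ × ℝ) : ℝ :=
  c.sum fun i a => a * (Ioc (0 : ℝ) i.1 ×ˢ i.2.1).indicator (fun _ => (1 : ℝ)) z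

/-- The integral `∑ a * W (t, A)` of an elementary function `∑ a * 1_{(0, t] × A}`. -/
noncomputable def stepIntegral {Ω : Type*} (W : ℝ≥0 × BoundedBorel → Ω → ℝ)
    (c : ℝ≥0 × BoundedBorel →₀ ℝ) (ω : Ω) : ℝ :=
  c.sum fun i a => a * W i ω

/-- Lebesgue measure on `(0, ∞) × ℝ`, as a measure on `ℝ × ℝ`. -/
noncomputable def halfPlaneMeasure : Measure (ℝ × ℝ) :=
  volume.restrict (Ioi (0 : ℝ) ×ˢ univ)

/-- `X` is (a version of) the Wiener integral `∫∫ f(s, y) dW(s, y)` of the square integrable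
function `f` on `(0, ∞) × ℝ`: the limit in `L²(P)` of the integrals of elementary functions that
converge to `f` in `L²((0, ∞) × ℝ)`. -/
def IsWienerIntegral {Ω : Type*} [MeasurableSpace Ω] (P : Measure Ω)
    (W : ℝ≥0 × BoundedBorel → Ω → ℝ) (f : ℝ × ℝ → ℝ) (X : Ω → ℝ) : Prop :=
  MemLp f 2 halfPlaneMeasure ∧ MemLp X 2 P ∧
    ∃ c : ℕ → (ℝ≥0 × BoundedBorel →₀ ℝ),
      Tendsto (fun n => eLpNorm (fun z => stepFunction (c n) z - f z) 2 halfPlaneMeasure)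
        atTop (𝓝 0) ∧
      Tendsto (fun n => eLpNorm (fun ω => stepIntegral W (c n) ω - X ω) 2 P) atTop (𝓝 0)

/-! ### The stochastic heat equation -/

/-- The Green kernel of `∂ₜ - (1/2) ∂ₓₓ` on the real line. -/
noncomputable def heatKernel (t x : ℝ) : ℝ :=
  if 0 < t then (2 * Real.pi * t) ^ (-(1 / 2) : ℝ) * Real.exp (-(|x| ^ 2) / (2 * t)) else 0

/-- `u` is (a version of) the mild solution on `[0, T] × ℝ` of
`∂ₜ u = (1/2) ∂ₓₓ u + ∂ₜ∂ₓ W`, `u(0, ·) = 0`, that is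
`u(t, x) = ∫_0^t ∫_ℝ G(t - s, x - y) dW(s, y)`. The kernel vanishes for `s ≥ t`. -/
def IsMildSolution {Ω : Type*} [MeasurableSpace Ω] (P : Measure Ω)
    (W : ℝ≥0 × BoundedBorel → Ω → ℝ) (T : ℝ) (u : ℝ → ℝ → Ω → ℝ) : Prop :=
  ∀ t ∈ Icc 0 T, ∀ x : ℝ,
    IsWienerIntegral P W (fun z => heatKernel (t - z.1) (x - z.2)) (u t x)

/-! ### Local times -/

/-- `L ξ t` is a local time of the path `θ` on `[0, T]`: for every `t ∈ [0, T]` the function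
`ξ ↦ L ξ t` is nonnegative and is the density, with respect to Lebesgue measure, of the occupation
measure `A ↦ |{s ∈ [0, t] : θ s ∈ A}|`. -/
def IsLocalTime (T : ℝ) (θ : ℝ → ℝ) (L : ℝ → ℝ → ℝ) : Prop :=
  ∀ t ∈ Icc 0 T, (∀ ξ, 0 ≤ L ξ t) ∧ ∀ A : Set ℝ, MeasurableSet A →
    volume {s | s ∈ Icc 0 t ∧ θ s ∈ A} = ∫⁻ ξ in A, ENNReal.ofReal (L ξ t)

/-- `L` is a local time of `θ` on `[0, T]` that is continuous in `(ξ, t)`. -/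
def IsJointlyContinuousLocalTime (T : ℝ) (θ : ℝ → ℝ) (L : ℝ → ℝ → ℝ) : Prop :=
  IsLocalTime T θ L ∧ ContinuousOn (fun q : ℝ × ℝ => L q.1 q.2) (univ ×ˢ Icc 0 T)

/-! ### Modular Besov spaces -/

/-- The `L^p`-modulus of continuity
`sup_{|s| ≤ t} (∫_{I_s} |f(x + s) - f(x)|^p dx)^{1/p}`, with `I_s = {x ∈ I : x + s ∈ I}`. -/
noncomputable def lpModulus (p : ℝ) (I : Set ℝ) (f : ℝ → ℝ) (t : ℝ) : ℝ≥0∞ :=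
  ⨆ (s : ℝ) (_ : |s| ≤ t),
    (∫⁻ x in {x | x ∈ I ∧ x + s ∈ I}, ENNReal.ofReal (|f (x + s) - f x| ^ p)) ^ (1 / p)

/-- The modulus `t ^ α * (log (1 / t)) ^ lam`, for `0 < t < 1`. -/
noncomputable def logModulus (α lam t : ℝ) : ℝ := t ^ α * Real.log (1 / t) ^ lam

/-- The norm `‖f‖_{L^p(I)} + sup_{0 < t ≤ t₀} Δ_p(f, I)(t) / w(t)`. -/
noncomputable def modularBesovNorm (w : ℝ → ℝ) (p : ℝ) (I : Set ℝ) (t₀ : ℝ) (f : ℝ → ℝ) : ℝ≥0∞ :=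
  eLpNorm f (ENNReal.ofReal p) (volume.restrict I) +
    ⨆ (t : ℝ) (_ : t ∈ Ioc 0 t₀), lpModulus p I f t / ENNReal.ofReal (w t)

/-- `f` belongs to the modular Besov space of the modulus `w` on `I`. Only the behaviour of `w` at
`0` matters: since `t ^ α * (log (1 / t)) ^ lam` vanishes at `t = 1`, the supremum in the norm is
taken over `0 < t ≤ t₀`, and finiteness is required for every `t₀ < 1`. -/
def MemModularBesov (w : ℝ → ℝ) (p : ℝ) (I : Set ℝ) (f : ℝ → ℝ) : Prop :=
  MemLp f (ENNReal.ofReal p) (volume.restrict I) ∧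
    ∀ t₀ ∈ Ioo (0 : ℝ) 1, modularBesovNorm w p I t₀ f < ∞

end StochasticHeat

/-! ### Linearity of the elementary integral -/

namespace StochasticHeat

variable {Ω : Type*} {W : ℝ≥0 × BoundedBorel → Ω → ℝ}

/-! Fix `x` and write `u(t)` for the solution at `x`. The noise in the time window `(a, t]`
contributes to `u(t)` a centered Gaussian variable of variance `√((t - a)/π)`, independent of the
values of `u` at times up to `a` and of the rest of `u(t)` (`IsMildSolution.exists_decomposition`).
This independence is used in two ways, recorded in `IsNondeterministic` for a jointly measurable
version of the process: conditionally on the past up to `a`, the probability that `u(t)` is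
`ε`-close to `ξ` is at most `2ε (t - a)^(-1/4)`; and the characteristic function at `θ` of `u(t) -
u(s)` is at most `exp(-θ² √((t - s)/π)/2)` in modulus.

Besov regularity. Ordering the visit times and integrating the first bound repeatedly shows that the
time spent `ε`-close to `ξ` during `(a, t]`, divided by `2ε`, has `p`-th moment of order `(t -
a)^(3p/4)`, uniformly in `ε` and `ξ` (`setLIntegral_volume_pow_le`,
`exists_lintegral_volume_rpow_le`). A continuous local time is the limit of these quotients as `ε →
0`, so Fatou's lemma transfers the bound to its increments. It is also monotone in time, so its
`L^p` modulus at scale `2^(-j)` is controlled by one symmetric increment, without a supremum over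
shifts. The `p`-th powers of these quantities, divided by those of the weights `2^(-3j/4) (j +
1)^λ`, have expectations of order `(j + 1)^(-λp)`. Since `λp > 1` they are summable, hence almost
surely bounded in `j` (`ae_exists_liminf_incrementEnergy_le`, `memModularBesov_of_monotoneOn`).

Existence of the local time. The second bound, integrated against `1 + v²`, gives `|r - s|^(-3/4)`,
which is integrable in time. Hence the Sobolev energy of the occupation measure of `(a, b]` has
expectation of order `(b - a)^(5/4)` (`exists_lintegral_occupationEnergy_le`). As `5/4 > 1`, the
energies of all dyadic time intervals have an almost surely finite sum. By Cauchy-Schwarz and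
Fourier inversion (`exists_continuous_density`) each dyadic interval then carries a continuous
density, with a uniform bound that tends to zero with the length. Gluing these densities by means of
the upper density yields joint continuity (`HasDyadicDensities.isJointlyContinuousLocalTime`). -/

lemma stepIntegral_eq (c : ℝ≥0 × BoundedBorel →₀ ℝ) :
    stepIntegral W c = fun ω => ∑ i ∈ c.support, c i * W i ω := rfl

lemma stepIntegral_add (c d : ℝ≥0 × BoundedBorel →₀ ℝ) (ω : Ω) :
    stepIntegral W (c + d) ω = stepIntegral W c ω + stepIntegral W d ω := by
  unfold stepIntegral
  rw [Finsupp.sum_add_index'] <;> intros <;> ring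

lemma stepIntegral_smul (b : ℝ) (c : ℝ≥0 × BoundedBorel →₀ ℝ) (ω : Ω) :
    stepIntegral W (b • c) ω = b * stepIntegral W c ω := by
  unfold stepIntegral
  rw [Finsupp.sum_smul_index (by intros; ring), Finsupp.sum, Finsupp.sum, Finset.mul_sum]
  exact Finset.sum_congr rfl fun i _ => by ring

lemma stepIntegral_sub (c d : ℝ≥0 × BoundedBorel →₀ ℝ) (ω : Ω) :
    stepIntegral W (c - d) ω = stepIntegral W c ω - stepIntegral W d ω := by
  have : c - d = c + (-1 : ℝ) • d := by simp [sub_eq_add_neg]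
  rw [this, stepIntegral_add, stepIntegral_smul]; ring

variable [MeasurableSpace Ω] {P : Measure Ω}

/-! ### Elementary integrands -/

lemma stepFunction_add (c d : ℝ≥0 × BoundedBorel →₀ ℝ) (z : ℝ × ℝ) :
    stepFunction (c + d) z = stepFunction c z + stepFunction d z := by
  unfold stepFunction
  rw [Finsupp.sum_add_index'] <;> intros <;> ring

lemma stepFunction_smul (b : ℝ) (c : ℝ≥0 × BoundedBorel →₀ ℝ) (z : ℝ × ℝ) :
    stepFunction (b • c) z = b * stepFunction c z := by
  unfold stepFunction
  rw [Finsupp.sum_smul_index (by intros; ring), Finsupp.sum, Finsupp.sum, Finset.mul_sum]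
  exact Finset.sum_congr rfl fun i _ => by ring

lemma stepFunction_sub (c d : ℝ≥0 × BoundedBorel →₀ ℝ) (z : ℝ × ℝ) :
    stepFunction (c - d) z = stepFunction c z - stepFunction d z := by
  have : c - d = c + (-1 : ℝ) • d := by simp [sub_eq_add_neg]
  rw [this, stepFunction_add, stepFunction_smul]; ring

/-- The space-time box `(0, t] × A` of an index `(t, A)` of the white noise. -/
def box (i : ℝ≥0 × BoundedBorel) : Set (ℝ × ℝ) := Ioc (0 : ℝ) i.1 ×ˢ i.2.1

lemma measurableSet_box (i : ℝ≥0 × BoundedBorel) : MeasurableSet (box i) :=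
  measurableSet_Ioc.prod i.2.2.1

lemma halfPlaneMeasure_box_inter (i j : ℝ≥0 × BoundedBorel) :
    halfPlaneMeasure.real (box i ∩ box j) =
      min (i.1 : ℝ) j.1 * volume.real (i.2.1 ∩ j.2.1) := by
  have h1 : box i ∩ box j ∩ (Ioi (0 : ℝ) ×ˢ univ) =
      Ioc (0 : ℝ) (min (i.1 : ℝ) j.1) ×ˢ (i.2.1 ∩ j.2.1) := by
    ext z; simp only [box, mem_inter_iff, mem_prod, mem_Ioc, mem_Ioi, mem_univ, le_min_iff]; tauto
  have h0 : (0 : ℝ) ≤ min (i.1 : ℝ) j.1 := le_min i.1.2 j.1.2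
  rw [Measure.real, halfPlaneMeasure,
    Measure.restrict_apply ((measurableSet_box i).inter (measurableSet_box j)), h1,
    Measure.volume_eq_prod, Measure.prod_prod, Real.volume_Ioc, sub_zero, ENNReal.toReal_mul,
    ENNReal.toReal_ofReal h0]
  rfl

lemma halfPlaneMeasure_box_lt_top (i : ℝ≥0 × BoundedBorel) : halfPlaneMeasure (box i) < ∞ := by
  refine (Measure.restrict_apply_le _ _).trans_lt ?_
  rw [box, Measure.volume_eq_prod, Measure.prod_prod]
  exact ENNReal.mul_lt_top (by simp) i.2.2.2.measure_lt_top

lemma stepFunction_eq (c : ℝ≥0 × BoundedBorel →₀ ℝ) :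
    stepFunction c = fun z => ∑ i ∈ c.support, c i * (box i).indicator (fun _ => (1 : ℝ)) z := rfl

lemma memLp_box_indicator (i : ℝ≥0 × BoundedBorel) :
    MemLp ((box i).indicator (fun _ => (1 : ℝ))) 2 halfPlaneMeasure :=
  memLp_indicator_const 2 (measurableSet_box i) 1 (Or.inr (halfPlaneMeasure_box_lt_top i).ne)

lemma memLp_stepFunction (c : ℝ≥0 × BoundedBorel →₀ ℝ) :
    MemLp (stepFunction c) 2 halfPlaneMeasure := by
  rw [stepFunction_eq]
  exact memLp_finsetSum _ fun i _ => (memLp_box_indicator i).const_mul (c i)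

lemma IsWhiteNoise.memLp (hW : IsWhiteNoise P W) (i : ℝ≥0 × BoundedBorel) : MemLp (W i) 2 P :=
  (hW.gaussian.hasGaussianLaw_eval i).memLp_two

lemma IsWhiteNoise.memLp_stepIntegral (hW : IsWhiteNoise P W) (c : ℝ≥0 × BoundedBorel →₀ ℝ) :
    MemLp (stepIntegral W c) 2 P := by
  rw [stepIntegral_eq]
  exact memLp_finsetSum _ fun i _ => (hW.memLp i).const_mul (c i)

lemma norm_cexp_mul_I_sub_le (a b : ℝ) :
    ‖Complex.exp (a * Complex.I) - Complex.exp (b * Complex.I)‖ ≤ ‖a - b‖ := by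
  have h : Complex.exp (a * Complex.I) - Complex.exp (b * Complex.I) =
      Complex.exp (b * Complex.I) * (Complex.exp (Complex.I * ((a - b : ℝ) : ℂ)) - 1) := by
    rw [mul_sub, mul_one, ← Complex.exp_add]
    congr 2
    push_cast
    ring
  rw [h, norm_mul, Complex.norm_exp_ofReal_mul_I, one_mul]
  exact Real.norm_exp_I_mul_ofReal_sub_one_le

/-- The covariance of the noise at two indices is the measure of the intersection of their boxes, so
both sides expand into the same double sum. -/
lemma IsWhiteNoise.integral_sq_stepIntegral (hW : IsWhiteNoise P W)
    (c : ℝ≥0 × BoundedBorel →₀ ℝ) :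
    ∫ ω, stepIntegral W c ω ^ 2 ∂P = ∫ z, stepFunction c z ^ 2 ∂halfPlaneMeasure := by
  have hl : ∀ ω, stepIntegral W c ω ^ 2 =
      ∑ i ∈ c.support, ∑ j ∈ c.support, c i * c j * (W i ω * W j ω) := fun ω => by
    rw [stepIntegral_eq, sq, Finset.sum_mul_sum]
    exact Finset.sum_congr rfl fun i _ => Finset.sum_congr rfl fun j _ => by ring
  have hr : ∀ z, stepFunction c z ^ 2 =
      ∑ i ∈ c.support, ∑ j ∈ c.support,
        c i * c j * (box i ∩ box j).indicator (fun _ => (1 : ℝ)) z := fun z => by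
    rw [stepFunction_eq, sq, Finset.sum_mul_sum]
    refine Finset.sum_congr rfl fun i _ => Finset.sum_congr rfl fun j _ => ?_
    by_cases h1 : z ∈ box i <;> by_cases h2 : z ∈ box j <;> simp [h1, h2]
  simp_rw [hl, hr]
  have hWi : ∀ i j, Integrable (fun ω => W i ω * W j ω) P := fun i j =>
    (hW.memLp i).integrable_mul (hW.memLp j)
  have hbi : ∀ i j, Integrable ((box i ∩ box j).indicator (fun _ => (1 : ℝ)))
      halfPlaneMeasure := fun i j =>
    (integrable_indicator_iff ((measurableSet_box i).inter (measurableSet_box j))).2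
      (integrableOn_const ((measure_mono inter_subset_left).trans_lt
        (halfPlaneMeasure_box_lt_top i)).ne)
  rw [integral_finsetSum _ fun i _ => integrable_finsetSum _ fun j _ => (hWi i j).const_mul _,
    integral_finsetSum _ fun i _ => integrable_finsetSum _ fun j _ => (hbi i j).const_mul _]
  refine Finset.sum_congr rfl fun i _ => ?_
  rw [integral_finsetSum _ fun j _ => (hWi i j).const_mul _,
    integral_finsetSum _ fun j _ => (hbi i j).const_mul _]
  refine Finset.sum_congr rfl fun j _ => ?_
  rw [integral_const_mul, integral_const_mul,
    integral_indicator_const _ ((measurableSet_box i).inter (measurableSet_box j)),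
    halfPlaneMeasure_box_inter, smul_eq_mul, mul_one]
  congr 1
  exact hW.covariance i.1 j.1 i.2 j.2

lemma eLpNorm_two_eq_of_integral_sq_eq {α β : Type*} [MeasurableSpace α] [MeasurableSpace β]
    {μ : Measure α} {ν : Measure β} {f : α → ℝ} {g : β → ℝ} (hf : MemLp f 2 μ) (hg : MemLp g 2 ν)
    (h : ∫ a, f a ^ 2 ∂μ = ∫ b, g b ^ 2 ∂ν) : eLpNorm f 2 μ = eLpNorm g 2 ν := by
  rw [hf.eLpNorm_eq_integral_rpow_norm (by simp) (by simp),
    hg.eLpNorm_eq_integral_rpow_norm (by simp) (by simp)]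
  simp [h]

lemma IsWhiteNoise.eLpNorm_stepIntegral (hW : IsWhiteNoise P W) (c : ℝ≥0 × BoundedBorel →₀ ℝ) :
    eLpNorm (stepIntegral W c) 2 P = eLpNorm (stepFunction c) 2 halfPlaneMeasure :=
  eLpNorm_two_eq_of_integral_sq_eq (hW.memLp_stepIntegral c) (memLp_stepFunction c)
    (hW.integral_sq_stepIntegral c)

lemma IsWhiteNoise.hasGaussianLaw_stepIntegral (hW : IsWhiteNoise P W)
    (c : ℝ≥0 × BoundedBorel →₀ ℝ) : HasGaussianLaw (stepIntegral W c) P :=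
  (hW.gaussian.smul c).hasGaussianLaw_fun_sum (I := c.support)

lemma IsWhiteNoise.integral_stepIntegral (hW : IsWhiteNoise P W)
    (c : ℝ≥0 × BoundedBorel →₀ ℝ) : ∫ ω, stepIntegral W c ω ∂P = 0 := by
  have := hW.gaussian.isProbabilityMeasure
  rw [stepIntegral_eq, integral_finsetSum _ fun i _ =>
    ((hW.memLp i).integrable (by norm_num)).const_mul _]
  exact Finset.sum_eq_zero fun i _ => by rw [integral_const_mul, hW.centered, mul_zero]

lemma IsWhiteNoise.integral_cexp_stepIntegral (hW : IsWhiteNoise P W)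
    (c : ℝ≥0 × BoundedBorel →₀ ℝ) :
    ∫ ω, Complex.exp (stepIntegral W c ω * Complex.I) ∂P =
      Complex.exp (-(∫ z, stepFunction c z ^ 2 ∂halfPlaneMeasure : ℝ) / 2) := by
  have := hW.gaussian.isProbabilityMeasure
  have hG := hW.hasGaussianLaw_stepIntegral c
  have h := hG.charFun_map_eq (1 : ℝ)
  rw [charFun_apply_real, integral_map hG.aemeasurable (by fun_prop)] at h
  simp only [Complex.ofReal_one, one_mul, RCLike.inner_apply, map_one, mul_one] at h
  rw [h, variance_eq_integral hG.aemeasurable]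
  simp only [hW.integral_stepIntegral, sub_zero, hW.integral_sq_stepIntegral]
  congr 1
  simp
  ring

/-! ### The Wiener integral -/

namespace IsWienerIntegral

variable {f g : ℝ × ℝ → ℝ} {X Y : Ω → ℝ}

lemma add (hW : IsWhiteNoise P W) (hX : IsWienerIntegral P W f X)
    (hY : IsWienerIntegral P W g Y) :
    IsWienerIntegral P W (fun z => f z + g z) (fun ω => X ω + Y ω) := by
  obtain ⟨hf, hX2, c, hcf, hcX⟩ := hX
  obtain ⟨hg, hY2, d, hdg, hdY⟩ := hY
  refine ⟨hf.add hg, hX2.add hY2, fun n => c n + d n, ?_, ?_⟩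
  · refine tendsto_of_tendsto_of_tendsto_of_le_of_le tendsto_const_nhds
      (by simpa using hcf.add hdg) (fun _ => zero_le) fun n => ?_
    refine le_trans (le_of_eq ?_) (eLpNorm_add_le
      ((memLp_stepFunction (c n)).sub hf).aestronglyMeasurable
      ((memLp_stepFunction (d n)).sub hg).aestronglyMeasurable (by norm_num))
    congr 1; ext z; simp [stepFunction_add]; ring
  · refine tendsto_of_tendsto_of_tendsto_of_le_of_le tendsto_const_nhds
      (by simpa using hcX.add hdY) (fun _ => zero_le) fun n => ?_
    refine le_trans (le_of_eq ?_) (eLpNorm_add_le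
      ((hW.memLp_stepIntegral (c n)).sub hX2).aestronglyMeasurable
      ((hW.memLp_stepIntegral (d n)).sub hY2).aestronglyMeasurable (by norm_num))
    congr 1; ext z; simp [stepIntegral_add]; ring

lemma const_mul (b : ℝ) (hX : IsWienerIntegral P W f X) :
    IsWienerIntegral P W (fun z => b * f z) (fun ω => b * X ω) := by
  obtain ⟨hf, hX2, c, hcf, hcX⟩ := hX
  refine ⟨hf.const_mul b, hX2.const_mul b, fun n => b • c n, ?_, ?_⟩
  · have := ENNReal.Tendsto.const_mul (a := ‖b‖ₑ) hcf (Or.inr (by simp))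
    rw [mul_zero] at this
    refine this.congr fun n => ?_
    rw [← eLpNorm_const_smul]
    congr 1; ext z; simp [stepFunction_smul]; ring
  · have := ENNReal.Tendsto.const_mul (a := ‖b‖ₑ) hcX (Or.inr (by simp))
    rw [mul_zero] at this
    refine this.congr fun n => ?_
    rw [← eLpNorm_const_smul]
    congr 1; ext z; simp [stepIntegral_smul]; ring

lemma sub (hW : IsWhiteNoise P W) (hX : IsWienerIntegral P W f X)
    (hY : IsWienerIntegral P W g Y) :
    IsWienerIntegral P W (fun z => f z - g z) (fun ω => X ω - Y ω) := by
  simpa [sub_eq_add_neg] using hX.add hW (hY.const_mul (-1))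

lemma zero : IsWienerIntegral P W (fun _ => 0) (fun _ => 0) :=
  ⟨MemLp.zero', MemLp.zero', fun _ => 0, by simp [stepFunction], by simp [stepIntegral]⟩

lemma sum (hW : IsWhiteNoise P W) {ι : Type*} (s : Finset ι) {f : ι → ℝ × ℝ → ℝ}
    {X : ι → Ω → ℝ} (h : ∀ i ∈ s, IsWienerIntegral P W (f i) (X i)) :
    IsWienerIntegral P W (fun z => ∑ i ∈ s, f i z) (fun ω => ∑ i ∈ s, X i ω) := by
  classical
  induction s using Finset.induction_on with
  | empty => simpa using zero
  | insert i s hi ih =>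
    simp only [Finset.sum_insert hi]
    exact (h i (by simp)).add hW (ih fun j hj => h j (by simp [hj]))

/-- Limit of the formula for elementary integrands: the exponents converge with the `L²` norms, and
the expectations because `y ↦ exp(iy)` is 1-Lipschitz. Applied to linear combinations, this single
formula yields all Gaussian laws and independence statements for Wiener integrals. -/
lemma integral_cexp (hW : IsWhiteNoise P W) (hX : IsWienerIntegral P W f X) :
    ∫ ω, Complex.exp (X ω * Complex.I) ∂P =
      Complex.exp (-(∫ z, f z ^ 2 ∂halfPlaneMeasure : ℝ) / 2) := by
  have := hW.gaussian.isProbabilityMeasure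
  obtain ⟨hf, hX2, c, hcf, hcX⟩ := hX
  have hnorm : Tendsto (fun n => eLpNorm (stepFunction (c n)) 2 halfPlaneMeasure) atTop
      (𝓝 (eLpNorm f 2 halfPlaneMeasure)) := by
    have := (Lp.tendsto_Lp_iff_tendsto_eLpNorm'' (fun n => stepFunction (c n))
      (fun n => memLp_stepFunction (c n)) f hf).2 hcf
    have h2 := this.enorm
    simpa using h2
  have hsq : ∀ {h : ℝ × ℝ → ℝ}, MemLp h 2 halfPlaneMeasure →
      ∫ z, h z ^ 2 ∂halfPlaneMeasure = (eLpNorm h 2 halfPlaneMeasure).toReal ^ 2 := by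
    intro h hh
    have h0 : 0 ≤ ∫ z, h z ^ 2 ∂halfPlaneMeasure := integral_nonneg fun _ => sq_nonneg _
    rw [hh.eLpNorm_eq_integral_rpow_norm (by simp) (by simp),
      ENNReal.toReal_ofReal (by positivity)]
    simp only [ENNReal.toReal_ofNat, Real.rpow_ofNat, Real.norm_eq_abs, sq_abs]
    rw [← Real.rpow_natCast, ← Real.rpow_mul h0]; norm_num
  have hlim : Tendsto (fun n => Complex.exp
      (-(∫ z, stepFunction (c n) z ^ 2 ∂halfPlaneMeasure : ℝ) / 2)) atTop
      (𝓝 (Complex.exp (-(∫ z, f z ^ 2 ∂halfPlaneMeasure : ℝ) / 2))) := by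
    have h1 : Tendsto (fun n => ∫ z, stepFunction (c n) z ^ 2 ∂halfPlaneMeasure) atTop
        (𝓝 (∫ z, f z ^ 2 ∂halfPlaneMeasure)) := by
      rw [hsq hf]; simp_rw [fun n => hsq (memLp_stepFunction (c n))]
      exact ((ENNReal.tendsto_toReal hf.eLpNorm_ne_top).comp hnorm).pow 2
    exact (Complex.continuous_exp.tendsto _).comp
      (((Complex.continuous_ofReal.tendsto _).comp h1).neg.div_const 2)
  have hlim2 : Tendsto (fun n => ∫ ω, Complex.exp (stepIntegral W (c n) ω * Complex.I) ∂P) atTop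
      (𝓝 (∫ ω, Complex.exp (X ω * Complex.I) ∂P)) := by
    have hint : ∀ {Y : Ω → ℝ}, MemLp Y 2 P →
        Integrable (fun ω => Complex.exp (Y ω * Complex.I)) P := fun hY => by
      refine Integrable.of_bound (C := 1) ?_ (ae_of_all _ fun ω => by
        simp [Complex.norm_exp_ofReal_mul_I])
      have := hY.aestronglyMeasurable.aemeasurable
      exact (by fun_prop : AEMeasurable _ P).aestronglyMeasurable
    rw [tendsto_iff_norm_sub_tendsto_zero]
    refine squeeze_zero (g := fun n => (eLpNorm (fun ω => stepIntegral W (c n) ω - X ω) 2 P).toReal)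
      (fun _ => norm_nonneg _) (fun n => ?_) ?_
    · rw [← integral_sub (hint (hW.memLp_stepIntegral _)) (hint hX2)]
      have hm : MemLp (fun ω => stepIntegral W (c n) ω - X ω) 2 P :=
        (hW.memLp_stepIntegral _).sub hX2
      calc _ ≤ ∫ ω, ‖Complex.exp (stepIntegral W (c n) ω * Complex.I) -
              Complex.exp (X ω * Complex.I)‖ ∂P := norm_integral_le_integral_norm _
        _ ≤ ∫ ω, ‖stepIntegral W (c n) ω - X ω‖ ∂P := by
            refine integral_mono ((hint (hW.memLp_stepIntegral _)).sub (hint hX2)).norm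
              (hm.integrable (by norm_num)).norm fun ω => ?_
            exact norm_cexp_mul_I_sub_le _ _
        _ = (eLpNorm (fun ω => stepIntegral W (c n) ω - X ω) 1 P).toReal := by
            rw [eLpNorm_one_eq_lintegral_enorm, integral_norm_eq_lintegral_enorm
              hm.aestronglyMeasurable]
        _ ≤ _ := ENNReal.toReal_mono hm.eLpNorm_ne_top
            (eLpNorm_le_eLpNorm_of_exponent_le (by norm_num) hm.aestronglyMeasurable)
    · exact (ENNReal.tendsto_toReal ENNReal.zero_ne_top).comp hcX
  refine tendsto_nhds_unique hlim2 ?_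
  simp_rw [hW.integral_cexp_stepIntegral]
  exact hlim

end IsWienerIntegral

end StochasticHeat


/-! ### Splitting a Wiener integral at a time, and independence -/

namespace StochasticHeat

variable {Ω : Type*} [MeasurableSpace Ω] {P : Measure Ω} {W : ℝ≥0 × BoundedBorel → Ω → ℝ}

/-- The restriction to `(0, a] × ℝ` of an elementary integrand. -/
noncomputable def truncate (a : ℝ≥0) (c : ℝ≥0 × BoundedBorel →₀ ℝ) : ℝ≥0 × BoundedBorel →₀ ℝ :=
  c.mapDomain fun i => (min i.1 a, i.2)

lemma stepFunction_sub_truncate (a : ℝ≥0) (c : ℝ≥0 × BoundedBorel →₀ ℝ) :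
    stepFunction (c - truncate a c) =
      {z : ℝ × ℝ | (a : ℝ) < z.1}.indicator (stepFunction c) := by
  ext z
  rw [stepFunction_sub]
  have h : stepFunction (truncate a c) z = if z.1 ≤ a then stepFunction c z else 0 := by
    rw [stepFunction, truncate, Finsupp.sum_mapDomain_index (by simp) (by intros; ring)]
    split_ifs with hz
    · refine Finsupp.sum_congr fun i _ => ?_
      congr 1
      refine indicator_eq_indicator ?_ rfl
      simp [hz]
    · refine Finset.sum_eq_zero fun i _ => ?_
      refine mul_eq_zero_of_right _ (indicator_of_notMem ?_ _)
      simp only [mem_prod, mem_Ioc, NNReal.coe_min, le_min_iff]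
      tauto
  rw [h, indicator_apply]
  by_cases hz : z.1 ≤ a
  · simp [hz, not_lt.2 hz]
  · simp [hz, not_le.1 hz]

namespace IsWienerIntegral

variable {f g : ℝ × ℝ → ℝ} {X Y : Ω → ℝ}

/-- Cutting the approximating elementary functions at time `a` contracts `L²` distances, so they
still converge; by the isometry their integrals are Cauchy, and completeness of `L²(P)` supplies
`Z`. -/
lemma exists_indicator (hW : IsWhiteNoise P W) (hX : IsWienerIntegral P W f X) (a : ℝ≥0) :
    ∃ Z, IsWienerIntegral P W ({z : ℝ × ℝ | (a : ℝ) < z.1}.indicator f) Z := by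
  obtain ⟨hf, -, c, hcf, -⟩ := hX
  have hS : MeasurableSet {z : ℝ × ℝ | (a : ℝ) < z.1} :=
    measurableSet_lt measurable_const measurable_fst
  have hfS := hf.indicator hS
  set d := fun n => c n - truncate a (c n)
  have hd : Tendsto (fun n => eLpNorm (stepFunction (d n) -
      {z : ℝ × ℝ | (a : ℝ) < z.1}.indicator f) 2 halfPlaneMeasure) atTop (𝓝 0) := by
    refine tendsto_of_tendsto_of_tendsto_of_le_of_le tendsto_const_nhds hcf
      (fun _ => zero_le) fun n => ?_
    simp only [d]
    rw [stepFunction_sub_truncate, ← indicator_sub']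
    exact eLpNorm_indicator_le _
  have hc1 := ((Lp.tendsto_Lp_iff_tendsto_eLpNorm'' (fun n => stepFunction (d n))
    (fun n => memLp_stepFunction (d n)) _ hfS).2 hd).cauchySeq
  have hc2 : CauchySeq fun n => (hW.memLp_stepIntegral (d n)).toLp (stepIntegral W (d n)) := by
    rw [EMetric.cauchySeq_iff] at hc1 ⊢
    intro ε hε
    obtain ⟨N, hN⟩ := hc1 ε hε
    refine ⟨N, fun m hm n hn => ?_⟩
    have := hN m hm n hn
    rw [Lp.edist_toLp_toLp] at this ⊢
    have e1 : stepIntegral W (d m) - stepIntegral W (d n) = stepIntegral W (d m - d n) := by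
      ext; simp [stepIntegral_sub]
    have e2 : stepFunction (d m) - stepFunction (d n) = stepFunction (d m - d n) := by
      ext; simp [stepFunction_sub]
    rwa [e1, hW.eLpNorm_stepIntegral, ← e2]
  obtain ⟨Z, hZ⟩ := cauchySeq_tendsto_of_complete hc2
  refine ⟨Z, hfS, Lp.memLp Z, d, hd, ?_⟩
  rw [← Lp.toLp_coeFn Z (Lp.memLp Z)] at hZ
  exact (Lp.tendsto_Lp_iff_tendsto_eLpNorm'' _ (fun n => hW.memLp_stepIntegral (d n)) _
    (Lp.memLp Z)).1 hZ

lemma aemeasurable (hX : IsWienerIntegral P W f X) : AEMeasurable X P :=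
  hX.2.1.aestronglyMeasurable.aemeasurable

lemma charFun_map (hW : IsWhiteNoise P W) (hX : IsWienerIntegral P W f X) (θ : ℝ) :
    charFun (P.map X) θ =
      Complex.exp (-(θ ^ 2 * ∫ z, f z ^ 2 ∂halfPlaneMeasure : ℝ) / 2) := by
  rw [charFun_apply_real, integral_map hX.aemeasurable (by fun_prop)]
  have := (hX.const_mul θ).integral_cexp hW
  simp only [mul_pow, integral_const_mul] at this
  rw [← this]
  simp

lemma map_eq_gaussianReal (hW : IsWhiteNoise P W) (hX : IsWienerIntegral P W f X) :
    P.map X = gaussianReal 0 (∫ z, f z ^ 2 ∂halfPlaneMeasure).toNNReal := by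
  have := hW.gaussian.isProbabilityMeasure
  have : IsProbabilityMeasure (P.map X) := Measure.isProbabilityMeasure_map hX.aemeasurable
  refine Measure.ext_of_charFun ?_
  ext θ
  rw [hX.charFun_map hW, charFun_gaussianReal, Real.coe_toNNReal _
    (integral_nonneg fun _ => sq_nonneg _)]
  congr 1
  push_cast
  ring

/-- Since the products `g i * f` vanish, the square norm of a combination of the integrands splits
into two sums, so the joint characteristic function factorizes. -/
lemma indepFun (hW : IsWhiteNoise P W) {ι : Type*} [Fintype ι] {g : ι → ℝ × ℝ → ℝ}
    {V : ι → Ω → ℝ} (hV : ∀ i, IsWienerIntegral P W (g i) (V i)) (hX : IsWienerIntegral P W f X)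
    (hfg : ∀ i z, g i z * f z = 0) : IndepFun (fun ω i => V i ω) X P := by
  classical
  have := hW.gaussian.isProbabilityMeasure
  have hVm : AEMeasurable (fun ω i => V i ω) P := aemeasurable_pi_lambda _ fun i =>
    (hV i).aemeasurable
  rw [indepFun_iff_charFunDual_prod hVm hX.aemeasurable]
  intro L
  rw [charFunDual_apply, charFunDual_apply, charFunDual_apply,
    integral_map (hVm.prodMk hX.aemeasurable) (by fun_prop), integral_map hVm (by fun_prop),
    integral_map hX.aemeasurable (by fun_prop)]
  -- In coordinates, `L` applied to the random vector is again a Wiener integral, so `integral_cexp`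
  -- computes all three characteristic functions.
  set b : ι → ℝ := fun i => L (Pi.single i 1, 0)
  set e : ℝ := L (0, 1)
  have h1 : ∀ v : ι → ℝ, L (v, 0) = ∑ i, b i * v i := fun v => by
    have hv : (v, (0 : ℝ)) = ∑ i, v i • ((Pi.single i 1 : ι → ℝ), (0 : ℝ)) := by
      refine Prod.ext ?_ ?_
      · ext j
        simp [Prod.fst_sum, Finset.sum_apply, Pi.single_apply]
      · simp [Prod.snd_sum]
    rw [hv, map_sum]
    exact Finset.sum_congr rfl fun i _ => by rw [map_smul, smul_eq_mul, mul_comm]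
  have h2 : ∀ y : ℝ, L (0, y) = e * y := fun y => by
    have hy : ((0 : ι → ℝ), y) = y • ((0 : ι → ℝ), (1 : ℝ)) := by simp
    rw [hy, map_smul, smul_eq_mul, mul_comm]
  have h3 : ∀ (v : ι → ℝ) (y : ℝ), L (v, y) = ∑ i, b i * v i + e * y := fun v y => by
    rw [← h1, ← h2, ← map_add]; simp
  have hs := sum hW Finset.univ fun i _ => (hV i).const_mul (b i)
  have hx := hX.const_mul e
  have e1 := hs.integral_cexp hW
  have e2 := hx.integral_cexp hW
  have e3 := (hs.add hW hx).integral_cexp hW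
  simp only [ContinuousLinearMap.comp_apply, ContinuousLinearMap.inl_apply,
    ContinuousLinearMap.inr_apply, h1, h2]
  simp only [h3]
  rw [e1, e2, e3, ← Complex.exp_add]
  congr 1
  have : ∫ z, (∑ i, b i * g i z + e * f z) ^ 2 ∂halfPlaneMeasure =
      ∫ z, (∑ i, b i * g i z) ^ 2 ∂halfPlaneMeasure + ∫ z, (e * f z) ^ 2 ∂halfPlaneMeasure := by
    rw [← integral_add hs.1.integrable_sq hx.1.integrable_sq]
    refine integral_congr_ae (ae_of_all _ fun z => ?_)
    have : (∑ i, b i * g i z) * f z = 0 := by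
      rw [Finset.sum_mul]
      exact Finset.sum_eq_zero fun i _ => by rw [mul_assoc, hfg, mul_zero]
    simp only
    linear_combination 2 * e * this
  rw [this]
  push_cast
  ring

end IsWienerIntegral

/-! ### The heat kernel -/

lemma heatKernel_of_pos {t : ℝ} (ht : 0 < t) (y : ℝ) :
    heatKernel t y ^ 2 = (2 * Real.pi * t)⁻¹ * Real.exp (-t⁻¹ * y ^ 2) := by
  rw [heatKernel, if_pos ht, mul_pow, ← Real.rpow_natCast, ← Real.rpow_mul (by positivity),
    ← Real.exp_nat_mul, sq_abs]
  congr 1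
  · rw [← Real.rpow_neg_one]; norm_num
  · congr 1
    push_cast
    field_simp

lemma integral_heatKernel_sq {t : ℝ} (ht : 0 < t) (x : ℝ) :
    ∫ y, heatKernel t (x - y) ^ 2 = (2 * √Real.pi)⁻¹ * t ^ (-(1 / 2) : ℝ) := by
  rw [integral_sub_left_eq_self (fun y => heatKernel t y ^ 2)]
  simp_rw [heatKernel_of_pos ht]
  rw [integral_const_mul, integral_gaussian, Real.rpow_neg ht.le, ← Real.sqrt_eq_rpow,
    div_inv_eq_mul, Real.sqrt_mul Real.pi_pos.le]
  have h1 := Real.mul_self_sqrt Real.pi_pos.le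
  have h2 := Real.mul_self_sqrt ht.le
  have h3 := Real.sqrt_pos.2 Real.pi_pos
  have h4 := Real.sqrt_pos.2 ht
  have h5 := Real.pi_pos
  field_simp
  nlinarith

/-- Integrating in space leaves `(2√π)⁻¹ (t - s)^(-1/2)` on `a < s < t`, whose time integral is the
variance of the fresh noise. -/
lemma integral_heatKernel_sq_indicator {a t : ℝ} (ha : 0 ≤ a) (hat : a ≤ t) (x : ℝ)
    (hG : MemLp (fun z : ℝ × ℝ => heatKernel (t - z.1) (x - z.2)) 2 halfPlaneMeasure) :
    ∫ z, ({z : ℝ × ℝ | a < z.1}.indicator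
      (fun z : ℝ × ℝ => heatKernel (t - z.1) (x - z.2)) z) ^ 2 ∂halfPlaneMeasure =
      √((t - a) / Real.pi) := by
  have hS : MeasurableSet {z : ℝ × ℝ | a < z.1} := measurableSet_lt measurable_const measurable_fst
  have hint := (hG.indicator hS).integrable_sq
  have hm : halfPlaneMeasure = ((volume : Measure ℝ).restrict (Ioi 0)).prod volume := by
    rw [halfPlaneMeasure, Measure.volume_eq_prod, ← Measure.prod_restrict, Measure.restrict_univ]
  rw [hm] at hint ⊢
  rw [integral_prod _ hint]
  have hinner : ∀ s, ∫ y, ({z : ℝ × ℝ | a < z.1}.indicator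
      (fun z : ℝ × ℝ => heatKernel (t - z.1) (x - z.2)) (s, y)) ^ 2 =
      (Ioo a t).indicator (fun s => (2 * √Real.pi)⁻¹ * (t - s) ^ (-(1 / 2) : ℝ)) s := by
    intro s
    by_cases h1 : a < s
    · by_cases h2 : s < t
      · simp only [indicator, mem_ofPred_eq, h1, if_true, mem_Ioo, h2, and_self]
        exact integral_heatKernel_sq (sub_pos.2 h2) x
      · simp [indicator, h1, h2, heatKernel]
    · simp [indicator, h1]
  simp_rw [hinner]
  rw [integral_indicator measurableSet_Ioo, Measure.restrict_restrict measurableSet_Ioo,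
    inter_eq_left.2 fun s hs => mem_Ioi.2 (ha.trans_lt hs.1), ← integral_Ioc_eq_integral_Ioo,
    ← intervalIntegral.integral_of_le hat, intervalIntegral.integral_const_mul,
    intervalIntegral.integral_comp_sub_left (fun s => s ^ (-(1 / 2) : ℝ)),
    integral_rpow (Or.inl (by norm_num)), Real.sqrt_div (sub_nonneg.2 hat), Real.sqrt_eq_rpow (t - a)]
  norm_num
  ring

/-- `u(t, x)` splits into a part measurable with respect to the noise before time `a` and an
independent Gaussian part of variance `√((t - a) / π)`. -/
lemma IsMildSolution.exists_decomposition (hW : IsWhiteNoise P W) {T : ℝ} {u : ℝ → ℝ → Ω → ℝ}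
    (hu : IsMildSolution P W T u) (x : ℝ) {a t : ℝ} (ha : 0 ≤ a) (hat : a ≤ t) (htT : t ≤ T)
    (R : Finset ℝ) (hR : ∀ r ∈ R, r ∈ Icc 0 a) :
    ∃ Y Z : Ω → ℝ, AEMeasurable Y P ∧ AEMeasurable Z P ∧ (∀ ω, u t x ω = Y ω + Z ω) ∧
      P.map Z = gaussianReal 0 (√((t - a) / Real.pi)).toNNReal ∧
      IndepFun (fun ω => ((fun r : R => u r x ω), Y ω)) Z P := by
  lift a to ℝ≥0 using ha
  have hut := hu t ⟨a.2.trans hat, htT⟩ x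
  obtain ⟨Z, hZ⟩ := hut.exists_indicator hW a
  have hY := hut.sub hW hZ
  refine ⟨fun ω => u t x ω - Z ω, Z, hY.aemeasurable, hZ.aemeasurable, fun ω => by ring, ?_, ?_⟩
  · rw [hZ.map_eq_gaussianReal hW]
    congr 2
    exact integral_heatKernel_sq_indicator a.2 hat x hut.1
  -- The index `none` carries the part of `u(t, x)` from before `a`, and `some r` the value at `r ≤
  -- a`, whose kernel vanishes after time `r`. All these integrands vanish where the integrand of
  -- `Z` lives.
  · have key := IsWienerIntegral.indepFun hW (ι := Option R)
      (V := fun i ω => i.elim (u t x ω - Z ω) (fun r => u r x ω))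
      (g := fun i z => i.elim (heatKernel (t - z.1) (x - z.2) -
        {z : ℝ × ℝ | (a : ℝ) < z.1}.indicator
          (fun z => heatKernel (t - z.1) (x - z.2)) z)
        (fun r => heatKernel (r - z.1) (x - z.2))) ?_ hZ ?_
    · exact key.comp (φ := fun v : Option R → ℝ => ((fun r : R => v (some r)), v none)) (ψ := id)
        (by fun_prop) measurable_id
    · rintro (_ | r)
      · exact hY
      · have hr := hR r r.2
        exact hu r ⟨hr.1, hr.2.trans (hat.trans htT)⟩ x
    · rintro (_ | r) z
      · by_cases hz : a < z.1 <;> simp [indicator, hz]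
      · by_cases hz : a < z.1
        · have : ¬ z.1 < (r : ℝ) := by linarith [(hR r r.2).2]
          simp [heatKernel, this]
        · simp [indicator, hz]

end StochasticHeat


namespace StochasticHeat

variable {Ω : Type*} [MeasurableSpace Ω] {P : Measure Ω} {W : ℝ≥0 × BoundedBorel → Ω → ℝ}

/-! ### Local nondeterminism -/

lemma gaussianReal_ball_le {v : ℝ≥0} (hv : v ≠ 0) (m y ε : ℝ) :
    gaussianReal m v (Metric.ball y ε) ≤
      ENNReal.ofReal (2 * ε * (√(2 * Real.pi * v))⁻¹) := by
  rw [gaussianReal_apply m hv]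
  calc ∫⁻ z in Metric.ball y ε, gaussianPDF m v z
      ≤ ∫⁻ _ in Metric.ball y ε, ENNReal.ofReal (√(2 * Real.pi * v))⁻¹ := by
        refine lintegral_mono fun z => ENNReal.ofReal_le_ofReal ?_
        rw [gaussianPDFReal]
        refine mul_le_of_le_one_right (by positivity) (Real.exp_le_one_iff.2 ?_)
        exact div_nonpos_of_nonpos_of_nonneg (neg_nonpos.2 (sq_nonneg _)) (by positivity)
    _ = _ := by
        rw [lintegral_const, Measure.restrict_apply_univ, Real.volume_ball, mul_comm,
          ← ENNReal.ofReal_mul' (by positivity)]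

/-- Given `(V, Y)`, the independent `Z` must fall in the ball of radius `ε` about `ξ - Y`, and the
bound `c` does not depend on the center. -/
lemma measure_inter_add_ball_le [IsProbabilityMeasure P] {α : Type*} [MeasurableSpace α]
    {V : Ω → α} {Y Z : Ω → ℝ} (hV : AEMeasurable V P) (hY : AEMeasurable Y P)
    (hZ : AEMeasurable Z P) (hind : IndepFun (fun ω => (V ω, Y ω)) Z P) {A : Set α}
    (hA : MeasurableSet A) {ε ξ : ℝ} {c : ℝ≥0∞} (hc : ∀ y, P.map Z (Metric.ball y ε) ≤ c) :
    P {ω | V ω ∈ A ∧ |Y ω + Z ω - ξ| < ε} ≤ c * P {ω | V ω ∈ A} := by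
  have hVY := hV.prodMk hY
  have hlaw := (indepFun_iff_map_prod_eq_prod_map_map hVY hZ).1 hind
  have : IsProbabilityMeasure (P.map Z) := Measure.isProbabilityMeasure_map hZ
  have : IsProbabilityMeasure (P.map fun ω => (V ω, Y ω)) := Measure.isProbabilityMeasure_map hVY
  set B : Set ((α × ℝ) × ℝ) := {q | q.1.1 ∈ A ∧ |q.1.2 + q.2 - ξ| < ε}
  have hB : MeasurableSet B :=
    (hA.preimage (measurable_fst.comp measurable_fst)).inter
      (measurableSet_lt (f := fun q : (α × ℝ) × ℝ => |q.1.2 + q.2 - ξ|) (by fun_prop)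
        measurable_const)
  calc P {ω | V ω ∈ A ∧ |Y ω + Z ω - ξ| < ε}
      = P.map (fun ω => ((V ω, Y ω), Z ω)) B := by
        rw [Measure.map_apply_of_aemeasurable (hVY.prodMk hZ) hB]; rfl
    _ = ∫⁻ q, P.map Z (Prod.mk q ⁻¹' B) ∂P.map (fun ω => (V ω, Y ω)) := by
        rw [hlaw, Measure.prod_apply hB]
    _ ≤ ∫⁻ q, (Prod.fst ⁻¹' A).indicator (fun _ => c) q ∂P.map (fun ω => (V ω, Y ω)) := by
        refine lintegral_mono fun q => ?_
        by_cases hq : q.1 ∈ A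
        · rw [indicator_of_mem (show q ∈ Prod.fst ⁻¹' A from hq)]
          refine le_trans (measure_mono fun z hz => ?_) (hc (ξ - q.2))
          have := hz.2
          rw [Metric.mem_ball, Real.dist_eq]
          convert this using 2
          ring
        · have : Prod.mk q ⁻¹' B = ∅ := by
            ext z; simp [B, hq]
          simp [this]
    _ = c * P {ω | V ω ∈ A} := by
        rw [lintegral_indicator_const (measurable_fst hA),
          Measure.map_apply_of_aemeasurable hVY (measurable_fst hA)]
        rfl

/-- The event that the process `X` is `ε`-close to `ξ` at all times of `R`. -/
def nearEvent (X : ℝ → Ω → ℝ) (ξ ε : ℝ) (R : Finset ℝ) : Set Ω :=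
  {ω | ∀ r ∈ R, |X r ω - ξ| < ε}

lemma sqrt_div_pi_bound {d : ℝ} (hd : 0 < d) :
    (√(2 * Real.pi * √(d / Real.pi)))⁻¹ ≤ d ^ (-(1 / 4) : ℝ) := by
  rw [Real.rpow_neg hd.le]
  refine inv_anti₀ (by positivity) ?_
  have h1 : d ^ (1 / 4 : ℝ) = √(√d) := by
    rw [Real.sqrt_eq_rpow, Real.sqrt_eq_rpow, ← Real.rpow_mul hd.le]; norm_num
  rw [h1]
  refine Real.sqrt_le_sqrt ?_
  rw [Real.sqrt_div hd.le]
  have h3 := Real.sqrt_pos.2 Real.pi_pos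
  have h5 : 1 ≤ √Real.pi := Real.one_le_sqrt.2 (by linarith [Real.pi_gt_three])
  have h6 : 2 * Real.pi * (√d / √Real.pi) = 2 * √Real.pi * √d := by
    have := Real.mul_self_sqrt Real.pi_pos.le
    field_simp
    linarith
  rw [h6]
  nlinarith [Real.sqrt_nonneg d]

/-- One-sided local nondeterminism: the noise after `a` leaves `u(t, x)` a conditional density of at
most `(t - a)^(-1/4)`, whatever happened at the earlier times `R`. -/
lemma IsMildSolution.measure_nearEvent_insert_le [IsProbabilityMeasure P]
    (hW : IsWhiteNoise P W) {T : ℝ}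
    {u : ℝ → ℝ → Ω → ℝ} (hu : IsMildSolution P W T u) (x ξ : ℝ) {ε a t : ℝ} (hε : 0 < ε)
    (ha : 0 ≤ a) (hat : a < t) (htT : t ≤ T) (R : Finset ℝ) (hR : ∀ r ∈ R, r ∈ Icc 0 a) :
    P (nearEvent (fun s => u s x) ξ ε (insert t R)) ≤
      ENNReal.ofReal (2 * ε * (t - a) ^ (-(1 / 4) : ℝ)) *
        P (nearEvent (fun s => u s x) ξ ε R) := by
  obtain ⟨Y, Z, hY, hZ, hYZ, hlaw, hind⟩ := hu.exists_decomposition hW x ha hat.le htT R hR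
  have hV : AEMeasurable (fun ω => fun r : R => u r x ω) P := aemeasurable_pi_lambda _ fun r =>
    (hu r ⟨(hR r r.2).1, (hR r r.2).2.trans (hat.le.trans htT)⟩ x).aemeasurable
  have hA : MeasurableSet {v : R → ℝ | ∀ r : R, |v r - ξ| < ε} := by
    rw [show {v : R → ℝ | ∀ r : R, |v r - ξ| < ε} = ⋂ r : R, {v : R → ℝ | |v r - ξ| < ε} by
      ext; simp]
    exact MeasurableSet.iInter fun r => measurableSet_lt (by fun_prop) measurable_const
  have hd : 0 < (t - a) / Real.pi := div_pos (sub_pos.2 hat) Real.pi_pos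
  have hc : ∀ y, P.map Z (Metric.ball y ε) ≤
      ENNReal.ofReal (2 * ε * (t - a) ^ (-(1 / 4) : ℝ)) := fun y => by
    rw [hlaw]
    refine (gaussianReal_ball_le ?_ _ _ _).trans (ENNReal.ofReal_le_ofReal ?_)
    · exact (Real.toNNReal_pos.2 (Real.sqrt_pos.2 hd)).ne'
    · rw [Real.coe_toNNReal _ (Real.sqrt_nonneg _)]
      exact mul_le_mul_of_nonneg_left (sqrt_div_pi_bound (sub_pos.2 hat)) (by positivity)
  refine le_trans (le_of_eq ?_) ((measure_inter_add_ball_le (ξ := ξ) hV hY hZ hind hA hc).trans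
    (le_of_eq ?_))
  · congr 1
    ext ω
    simp [nearEvent, hYZ, and_comm]
  · congr 2
    ext ω
    simp [nearEvent]

/-- The increment is the sum of `Y - u(s, x)` and the independent fresh noise. The first factor of
its characteristic function has modulus at most 1, and the second is an explicit Gaussian. -/
lemma IsMildSolution.norm_integral_cexp_sub_le [IsProbabilityMeasure P]
    (hW : IsWhiteNoise P W) {T : ℝ}
    {u : ℝ → ℝ → Ω → ℝ} (hu : IsMildSolution P W T u) (x θ : ℝ) {s t : ℝ}
    (hs : 0 ≤ s) (hst : s ≤ t) (htT : t ≤ T) :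
    ‖∫ ω, Complex.exp ((θ * (u t x ω - u s x ω) : ℝ) * Complex.I) ∂P‖ ≤
      Real.exp (-(θ ^ 2 * √((t - s) / Real.pi)) / 2) := by
  obtain ⟨Y, Z, hY, hZ, hYZ, hlaw, hind⟩ := hu.exists_decomposition hW x hs hst htT {s}
    (by simpa using hs)
  have hind' : IndepFun (fun ω => Y ω - u s x ω) Z P :=
    hind.comp (φ := fun q : (({s} : Finset ℝ) → ℝ) × ℝ => q.2 - q.1 ⟨s, by simp⟩) (ψ := id)
      (by fun_prop) measurable_id
  have hus := (hu s ⟨hs, hst.trans htT⟩ x).aemeasurable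
  have hYs : AEMeasurable (fun ω => Y ω - u s x ω) P := hY.sub hus
  have h := hind'.charFun_map_fun_add_eq_mul hYs hZ
  have h1 : ∫ ω, Complex.exp ((θ * (u t x ω - u s x ω) : ℝ) * Complex.I) ∂P =
      charFun (P.map fun ω => Y ω - u s x ω + Z ω) θ := by
    rw [charFun_apply_real, integral_map (by fun_prop) (by fun_prop)]
    refine integral_congr_ae (ae_of_all _ fun ω => ?_)
    simp only [hYZ]
    push_cast
    ring_nf
  have : IsProbabilityMeasure (P.map fun ω => Y ω - u s x ω) :=
    Measure.isProbabilityMeasure_map hYs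
  rw [h1, h, Pi.mul_apply, norm_mul]
  refine (mul_le_of_le_one_left (norm_nonneg _) (norm_charFun_le_one _)).trans (le_of_eq ?_)
  rw [hlaw, charFun_gaussianReal, Complex.norm_exp, Real.coe_toNNReal _ (Real.sqrt_nonneg _)]
  congr 1
  simp [← Complex.ofReal_pow, ← Complex.ofReal_mul]
  ring

/-- A measurable process `X` on `[0, T]` which has, at the times of a conull set `S`, the one-sided
local nondeterminism of a Gaussian process with increments of variance `|t - s| ^ (1/2)`. -/
structure IsNondeterministic (P : Measure Ω) (T : ℝ) (S : Set ℝ) (X : ℝ → Ω → ℝ) : Prop where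
  measurable : Measurable fun q : ℝ × Ω => X q.1 q.2
  ae_mem : ∀ᵐ t ∂volume.restrict (Icc 0 T), t ∈ S
  measure_insert_le : ∀ (ξ ε a t : ℝ), 0 < ε → 0 ≤ a → a < t → t ∈ S → ∀ R : Finset ℝ,
    (∀ r ∈ R, r ∈ S ∧ r ≤ a) → P (nearEvent X ξ ε (insert t R)) ≤
      ENNReal.ofReal (2 * ε * (t - a) ^ (-(1 / 4) : ℝ)) * P (nearEvent X ξ ε R)
  norm_integral_le : ∀ (θ : ℝ), ∀ s ∈ S, ∀ t ∈ S, s ≤ t →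
    ‖∫ ω, Complex.exp ((θ * (X t ω - X s ω) : ℝ) * Complex.I) ∂P‖ ≤
      Real.exp (-(θ ^ 2 * √((t - s) / Real.pi)) / 2)

/-- A measurable modification agrees with `u` only almost everywhere on the product. By Fubini it
agrees almost surely at almost every time, and `S` collects those times; there the estimates carry
over. -/
lemma IsMildSolution.exists_isNondeterministic [IsProbabilityMeasure P] (hW : IsWhiteNoise P W)
    {T : ℝ} {u : ℝ → ℝ → Ω → ℝ} (hu : IsMildSolution P W T u) (x : ℝ)
    (hmeas : AEMeasurable (fun q : ℝ × Ω => u q.1 x q.2) ((volume.restrict (Icc 0 T)).prod P)) :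
    ∃ (S : Set ℝ) (X : ℝ → Ω → ℝ), IsNondeterministic P T S X ∧
      ∀ᵐ ω ∂P, ∀ᵐ t ∂volume.restrict (Icc 0 T), u t x ω = X t ω := by
  set X : ℝ → Ω → ℝ := fun t ω => hmeas.mk _ (t, ω)
  have hae : ∀ᵐ q ∂(volume.restrict (Icc 0 T)).prod P, u q.1 x q.2 = X q.1 q.2 := hmeas.ae_eq_mk
  set S : Set ℝ := {t | t ∈ Icc 0 T ∧ ∀ᵐ ω ∂P, u t x ω = X t ω}
  have hnear : ∀ (ξ ε : ℝ) (R : Finset ℝ), (∀ r ∈ R, r ∈ S) →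
      P (nearEvent X ξ ε R) = P (nearEvent (fun s => u s x) ξ ε R) := by
    intro ξ ε R hR
    have h : ∀ᵐ ω ∂P, ∀ r : R, u r x ω = X r ω := ae_all_iff.2 fun r => (hR r r.2).2
    refine measure_congr ?_
    filter_upwards [h] with ω hω
    refine propext (forall₂_congr fun r hr => ?_)
    simp only [hω ⟨r, hr⟩]
  refine ⟨S, X, ⟨hmeas.measurable_mk, ?_, ?_, ?_⟩, ?_⟩
  · filter_upwards [Measure.ae_ae_of_ae_prod hae, ae_restrict_mem measurableSet_Icc] with t h1 h2
    exact ⟨h2, h1⟩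
  · intro ξ ε a t hε ha hat ht R hR
    rw [hnear ξ ε _ fun r hr => ?_, hnear ξ ε R fun r hr => (hR r hr).1]
    · exact hu.measure_nearEvent_insert_le hW x ξ hε ha hat ht.1.2 R fun r hr =>
        ⟨(hR r hr).1.1.1, (hR r hr).2⟩
    · rcases Finset.mem_insert.1 hr with rfl | h
      exacts [ht, (hR r h).1]
  · intro θ s hs t ht hst
    rw [← integral_congr_ae (f := fun ω => Complex.exp ((θ * (u t x ω - u s x ω) : ℝ) * Complex.I))]
    · exact hu.norm_integral_cexp_sub_le hW x θ hs.1.1 hst ht.1.2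
    · filter_upwards [hs.2, ht.2] with ω h1 h2
      rw [h1, h2]
  · have := (Measure.measurePreserving_swap (μ := P)
      (ν := volume.restrict (Icc 0 T))).quasiMeasurePreserving.ae hae
    exact Measure.ae_ae_of_ae_prod this

end StochasticHeat


namespace StochasticHeat

variable {Ω : Type*} [MeasurableSpace Ω] {P : Measure Ω}

/-! ### Moments of occupation times -/

/-- The function `r ↦ -|B ∩ (r, t]|` is absolutely continuous with derivative `1_B` almost
everywhere; integrate the derivative of its power. Iterated, this orders the visit times, and the
factors `n + 1` build up `n!`. -/
lemma volume_inter_Ioc_pow_succ {B : Set ℝ} (hB : MeasurableSet B) {a t : ℝ} (hat : a ≤ t)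
    (n : ℕ) :
    volume (B ∩ Ioc a t) ^ (n + 1) =
      (n + 1) * ∫⁻ r in Ioc a t, B.indicator 1 r * volume (B ∩ Ioc r t) ^ n := by
  set φ : ℝ → ℝ := B.indicator 1
  have hφ : ∀ c d, IntervalIntegrable φ volume c d := fun c d => by
    rw [intervalIntegrable_iff]
    exact (integrableOn_const (by simp) (C := (1 : ℝ))).integrable.indicator hB
  set F : ℝ → ℝ := fun r => ∫ s in t..r, φ s
  have hF : ∀ r ∈ Icc a t, F r = -volume.real (B ∩ Ioc r t) := by
    intro r hr
    simp only [F]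
    rw [intervalIntegral.integral_symm, intervalIntegral.integral_of_le hr.2,
      integral_indicator_one hB, measureReal_restrict_apply hB]
  have hac : ∀ k : ℕ, AbsolutelyContinuousOnInterval (fun r => F r ^ (k + 1)) a t := by
    intro k
    induction k with
    | zero =>
      simpa using (hφ a t).absolutelyContinuousOnInterval_intervalIntegral (c := t) (by simp)
    | succ k ih =>
      simp_rw [pow_succ _ (k + 1)]
      exact ih.fun_mul
        ((hφ a t).absolutelyContinuousOnInterval_intervalIntegral (c := t) (by simp))
  have h1 := (hac n).integral_deriv_eq_sub
  have hFt : F t = 0 := by simp [F]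
  have h2 : ∀ᵐ r, r ∈ uIoc a t → deriv (fun r => F r ^ (n + 1)) r =
      (n + 1) * (-1) ^ n * (φ r * volume.real (B ∩ Ioc r t) ^ n) := by
    filter_upwards [(hφ a t).ae_hasDerivAt_integral] with r hr hrI
    have hd : HasDerivAt F (φ r) r := hr (uIoc_subset_uIcc hrI) t (by simp)
    rw [show (fun r => F r ^ (n + 1)) = F ^ (n + 1) from rfl, (hd.pow (n + 1)).deriv]
    rw [uIoc_of_le hat] at hrI
    rw [hF r (Ioc_subset_Icc_self hrI), neg_pow (volume.real _)]
    push_cast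
    ring
  rw [intervalIntegral.integral_congr_ae h2, hFt, hF a ⟨le_rfl, hat⟩,
    intervalIntegral.integral_const_mul, intervalIntegral.integral_of_le hat,
    neg_pow (volume.real _)] at h1
  have h3 : volume.real (B ∩ Ioc a t) ^ (n + 1) =
      (n + 1) * ∫ r in Ioc a t, φ r * volume.real (B ∩ Ioc r t) ^ n := by
    have h4 : ((-1 : ℝ) ^ n) * (-1) ^ n = 1 := by rw [← mul_pow]; norm_num
    have h5 := congrArg (fun y => (-1 : ℝ) ^ n * y) h1
    rw [zero_pow (Nat.succ_ne_zero n), pow_succ (-1 : ℝ) n] at h5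
    linear_combination -h5 + (∫ r in Ioc a t, φ r * volume.real (B ∩ Ioc r t) ^ n) * (n + 1) * h4
      - volume.real (B ∩ Ioc a t) ^ (n + 1) * h4
  have hfin : ∀ r, volume (B ∩ Ioc r t) ≠ ∞ := fun r =>
    ((measure_mono inter_subset_right).trans_lt (by simp)).ne
  have hmeas : Measurable fun r => volume (B ∩ Ioc r t) := by
    have : Antitone fun r => volume (B ∩ Ioc r t) := fun r s hrs =>
      measure_mono (inter_subset_inter_right _ (Ioc_subset_Ioc_left hrs))
    exact this.measurable
  have hint : ∫ r in Ioc a t, φ r * volume.real (B ∩ Ioc r t) ^ n =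
      (∫⁻ r in Ioc a t, B.indicator 1 r * volume (B ∩ Ioc r t) ^ n).toReal := by
    rw [integral_eq_lintegral_of_nonneg_ae]
    · congr 1
      refine lintegral_congr fun r => ?_
      by_cases hr : r ∈ B
      · simp [φ, hr, Measure.real, ENNReal.ofReal_pow, ENNReal.ofReal_toReal (hfin r)]
      · simp [φ, hr]
    · exact ae_of_all _ fun r => mul_nonneg (indicator_nonneg (by simp) r) (by positivity)
    · exact ((measurable_one.indicator hB).mul (hmeas.ennreal_toReal.pow_const n)).aestronglyMeasurable
  have hintfin : ∫⁻ r in Ioc a t, B.indicator 1 r * volume (B ∩ Ioc r t) ^ n ≠ ∞ := by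
    have hc : ∫⁻ _ in Ioc a t, volume (B ∩ Ioc a t) ^ n < ∞ := by
      rw [setLIntegral_const]
      exact ENNReal.mul_lt_top (ENNReal.pow_ne_top (hfin a)).lt_top (by simp)
    refine ((setLIntegral_mono measurable_const fun r hr => ?_).trans_lt hc).ne
    calc B.indicator 1 r * volume (B ∩ Ioc r t) ^ n ≤ 1 * volume (B ∩ Ioc a t) ^ n := by
          refine mul_le_mul' (indicator_le_self' (by simp) r) ?_
          exact pow_le_pow_left₀ zero_le (measure_mono
            (inter_subset_inter_right _ (Ioc_subset_Ioc_left hr.1.le))) n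
      _ = _ := one_mul _
  rw [hint] at h3
  rw [← ENNReal.toReal_eq_toReal_iff' (ENNReal.pow_ne_top (hfin a))
    (ENNReal.mul_ne_top (by finiteness) hintfin)]
  rw [ENNReal.toReal_pow, ENNReal.toReal_mul]
  change volume.real _ ^ _ = _
  rw [h3, ENNReal.toReal_add (by simp) (by simp), ENNReal.toReal_natCast, ENNReal.toReal_one]

lemma lintegral_rpow_sub_left {a t : ℝ} (hat : a ≤ t) :
    ∫⁻ r in Ioc a t, ENNReal.ofReal ((r - a) ^ (-(1 / 4) : ℝ)) =
      ENNReal.ofReal (4 / 3 * (t - a) ^ (3 / 4 : ℝ)) := by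
  have hi : IntervalIntegrable (fun r : ℝ => (r - a) ^ (-(1 / 4) : ℝ)) volume a t := by
    have := (intervalIntegral.intervalIntegrable_rpow' (r := (-(1 / 4) : ℝ)) (by norm_num)
      (a := 0) (b := t - a)).comp_sub_right a
    simpa using this
  rw [← ofReal_integral_eq_lintegral_ofReal ((intervalIntegrable_iff_integrableOn_Ioc_of_le hat).1 hi)
    ((ae_restrict_mem measurableSet_Ioc).mono fun r hr => Real.rpow_nonneg (sub_nonneg.2 hr.1.le) _),
    ← intervalIntegral.integral_of_le hat,
    intervalIntegral.integral_comp_sub_right (fun r => r ^ (-(1 / 4) : ℝ)),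
    integral_rpow (Or.inl (by norm_num))]
  congr 1
  norm_num
  ring

namespace IsNondeterministic

variable {T : ℝ} {S : Set ℝ} {X : ℝ → Ω → ℝ}

/-- The set of times at which the path of `X` is `ε`-close to `ξ`. -/
def nearTimes (X : ℝ → Ω → ℝ) (ξ ε : ℝ) (ω : Ω) : Set ℝ := {r | |X r ω - ξ| < ε}

lemma measurableSet_near (hX : IsNondeterministic P T S X) (ξ ε : ℝ) :
    MeasurableSet {q : ℝ × Ω | |X q.1 q.2 - ξ| < ε} :=
  measurableSet_lt (hX.measurable.sub_const ξ).abs measurable_const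

lemma measurableSet_nearTimes (hX : IsNondeterministic P T S X) (ξ ε : ℝ) (ω : Ω) :
    MeasurableSet (nearTimes X ξ ε ω) :=
  (hX.measurableSet_near ξ ε).preimage (measurable_id.prodMk measurable_const)

lemma measurableSet_nearEvent (hX : IsNondeterministic P T S X) (ξ ε : ℝ) (R : Finset ℝ) :
    MeasurableSet (nearEvent X ξ ε R) := by
  rw [show nearEvent X ξ ε R = ⋂ r ∈ R, {ω | |X r ω - ξ| < ε} by ext; simp [nearEvent]]
  exact Finset.measurableSet_biInter R fun r _ =>
    (hX.measurableSet_near ξ ε).preimage (measurable_const.prodMk measurable_id)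

lemma measurable_volume_nearTimes (hX : IsNondeterministic P T S X) (ξ ε : ℝ) :
    Measurable fun q : (ℝ × ℝ) × Ω => volume (nearTimes X ξ ε q.2 ∩ Ioc q.1.1 q.1.2) := by
  have hM : MeasurableSet {z : ((ℝ × ℝ) × Ω) × ℝ |
      |X z.2 z.1.2 - ξ| < ε ∧ z.1.1.1 < z.2 ∧ z.2 ≤ z.1.1.2} := by
    have h1 : MeasurableSet {z : ((ℝ × ℝ) × Ω) × ℝ | z.1.1.1 < z.2} :=
      measurableSet_lt (by fun_prop) (by fun_prop)
    have h2 : MeasurableSet {z : ((ℝ × ℝ) × Ω) × ℝ | z.2 ≤ z.1.1.2} :=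
      measurableSet_le (by fun_prop) (by fun_prop)
    exact ((hX.measurableSet_near ξ ε).preimage (f := fun z : ((ℝ × ℝ) × Ω) × ℝ => (z.2, z.1.2))
      (by fun_prop)).inter (h1.inter h2)
  exact measurable_measure_prodMk_left hM

lemma ae_mem_Ioc (hX : IsNondeterministic P T S X) {a t : ℝ} (ha : 0 ≤ a) (htT : t ≤ T) :
    ∀ᵐ r ∂volume.restrict (Ioc a t), r ∈ S :=
  ae_restrict_of_ae_restrict_of_subset
    (fun _ hr => mem_Icc.2 ⟨ha.trans hr.1.le, hr.2.trans htT⟩) hX.ae_mem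

/-- The finite set `R` of earlier visits is general so that the induction closes: the earliest visit
`r` in `(a, t]` is split off and joins `R`, and the other `n` visits fall in `(r, t]`. Each step
costs `2ε (r - a)^(-1/4)`, whose integral in `r` is `8/3 ε (t - a)^(3/4)`. -/
theorem setLIntegral_volume_pow_le [SFinite P] (hX : IsNondeterministic P T S X) (ξ : ℝ) {ε : ℝ}
    (hε : 0 < ε) (n : ℕ) : ∀ (a t : ℝ), 0 ≤ a → a ≤ t → t ≤ T → ∀ R : Finset ℝ,
    (∀ r ∈ R, r ∈ S ∧ r ≤ a) →
    ∫⁻ ω in nearEvent X ξ ε R, volume (nearTimes X ξ ε ω ∩ Ioc a t) ^ n ∂P ≤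
      ENNReal.ofReal (n.factorial * (8 / 3 * ε * (t - a) ^ (3 / 4 : ℝ)) ^ n) *
        P (nearEvent X ξ ε R) := by
  induction n with
  | zero => intros; simp
  | succ n ih =>
    intro a t ha hat htT R hR
    set c : ℝ := n.factorial * (8 / 3 * ε * (t - a) ^ (3 / 4 : ℝ)) ^ n
    have hc : 0 ≤ c := by have := sub_nonneg.2 hat; positivity
    have hmeas : Measurable fun q : Ω × ℝ =>
        (nearTimes X ξ ε q.1).indicator (1 : ℝ → ℝ≥0∞) q.2 *
          volume (nearTimes X ξ ε q.1 ∩ Ioc q.2 t) ^ n := by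
      refine Measurable.mul ?_ (Measurable.pow_const ?_ n)
      · exact (measurable_one (α := ℝ≥0∞)).indicator
          ((hX.measurableSet_near ξ ε).preimage measurable_swap)
      · exact (hX.measurable_volume_nearTimes ξ ε).comp
          (g := fun q : (ℝ × ℝ) × Ω => volume (nearTimes X ξ ε q.2 ∩ Ioc q.1.1 q.1.2))
          (f := fun q : Ω × ℝ => ((q.2, t), q.1)) (by fun_prop)
    have hmeas1 : Measurable fun ω => ∫⁻ r in Ioc a t,
        (nearTimes X ξ ε ω).indicator (1 : ℝ → ℝ≥0∞) r *
          volume (nearTimes X ξ ε ω ∩ Ioc r t) ^ n := hmeas.lintegral_prod_right'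
    calc ∫⁻ ω in nearEvent X ξ ε R, volume (nearTimes X ξ ε ω ∩ Ioc a t) ^ (n + 1) ∂P
        = (n + 1) * ∫⁻ ω in nearEvent X ξ ε R, (∫⁻ r in Ioc a t,
            (nearTimes X ξ ε ω).indicator 1 r *
              volume (nearTimes X ξ ε ω ∩ Ioc r t) ^ n) ∂P := by
          rw [← lintegral_const_mul _ hmeas1]
          exact lintegral_congr fun ω =>
            volume_inter_Ioc_pow_succ (hX.measurableSet_nearTimes ξ ε ω) hat n
      _ = (n + 1) * ∫⁻ r in Ioc a t, ∫⁻ ω in nearEvent X ξ ε R,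
            (nearTimes X ξ ε ω).indicator 1 r *
              volume (nearTimes X ξ ε ω ∩ Ioc r t) ^ n ∂P := by
          rw [lintegral_lintegral_swap hmeas.aemeasurable]
      _ ≤ (n + 1) * ∫⁻ r in Ioc a t, ENNReal.ofReal (c * (2 * ε)) * P (nearEvent X ξ ε R) *
            ENNReal.ofReal ((r - a) ^ (-(1 / 4) : ℝ)) := by
          refine mul_le_mul_right (lintegral_mono_ae ?_) _
          filter_upwards [hX.ae_mem_Ioc ha htT, ae_restrict_mem measurableSet_Ioc] with r hrS hr
          have h1 : ∀ ω, (nearEvent X ξ ε R).indicator (fun ω =>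
              (nearTimes X ξ ε ω).indicator 1 r * volume (nearTimes X ξ ε ω ∩ Ioc r t) ^ n) ω =
              (nearEvent X ξ ε (insert r R)).indicator
                (fun ω => volume (nearTimes X ξ ε ω ∩ Ioc r t) ^ n) ω := by
            intro ω
            by_cases h2 : ω ∈ nearEvent X ξ ε R <;> by_cases h3 : r ∈ nearTimes X ξ ε ω
            · have : ω ∈ nearEvent X ξ ε (insert r R) := by
                simp only [nearEvent, Finset.forall_mem_insert]; exact ⟨h3, h2⟩
              simp [h2, h3, this]
            · have : ω ∉ nearEvent X ξ ε (insert r R) := by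
                simp only [nearEvent, Finset.forall_mem_insert]; exact fun h => h3 h.1
              simp [h3, this]
            all_goals
              have : ω ∉ nearEvent X ξ ε (insert r R) := by
                simp only [nearEvent, Finset.forall_mem_insert]; exact fun h => h2 h.2
              simp [h2, this]
          rw [← lintegral_indicator (hX.measurableSet_nearEvent ξ ε R), lintegral_congr h1,
            lintegral_indicator (hX.measurableSet_nearEvent ξ ε _)]
          have hins : ∀ s ∈ insert r R, s ∈ S ∧ s ≤ r := fun s hs => by
            rcases Finset.mem_insert.1 hs with rfl | h
            exacts [⟨hrS, le_rfl⟩, ⟨(hR s h).1, (hR s h).2.trans hr.1.le⟩]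
          refine (ih r t (ha.trans hr.1.le) hr.2 htT _ hins).trans ?_
          calc _ ≤ ENNReal.ofReal c *
                (ENNReal.ofReal (2 * ε * (r - a) ^ (-(1 / 4) : ℝ)) * P (nearEvent X ξ ε R)) := by
                refine mul_le_mul' (ENNReal.ofReal_le_ofReal ?_)
                  (hX.measure_insert_le ξ ε a r hε ha hr.1 hrS R hR)
                -- Enlarging `t - r` to `t - a` makes the constant independent of `r`; only its
                -- growth in `n` suffers, and `n` stays fixed in the applications.
                have h5 : 0 ≤ t - r := sub_nonneg.2 hr.2
                have h6 : t - r ≤ t - a := by linarith [hr.1]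
                simp only [c]
                gcongr
            _ = _ := by
                rw [ENNReal.ofReal_mul (by positivity : (0 : ℝ) ≤ 2 * ε), ENNReal.ofReal_mul hc]
                ring
      _ = _ := by
          rw [lintegral_const_mul _ (by fun_prop), lintegral_rpow_sub_left hat]
          rw [mul_right_comm, ← ENNReal.ofReal_mul (by positivity),
            ← mul_assoc, show ((n : ℝ≥0∞) + 1) = ENNReal.ofReal (n + 1) by
              rw [ENNReal.ofReal_add (by positivity) (by positivity)]; simp,
            ← ENNReal.ofReal_mul (by positivity)]
          congr 2
          simp only [c]
          rw [Nat.factorial_succ]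
          push_cast
          ring

/-- Monotonicity of `L^p` norms on a probability space reduces real `p` to the integer moment `⌈p⌉`.
The normalization by `2ε` turns `8/3 ε` into `4/3`. -/
theorem exists_lintegral_volume_rpow_le [IsProbabilityMeasure P]
    (hX : IsNondeterministic P T S X) {p : ℝ} (hp : 0 < p) :
    ∃ C : ℝ≥0, ∀ (ξ ε a t : ℝ), 0 < ε → 0 ≤ a → a ≤ t → t ≤ T →
      ∫⁻ ω, (volume (nearTimes X ξ ε ω ∩ Ioc a t) / ENNReal.ofReal (2 * ε)) ^ p ∂P ≤
        C * ENNReal.ofReal ((t - a) ^ (3 / 4 : ℝ)) ^ p := by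
  set n := ⌈p⌉₊
  have hn : 0 < n := Nat.ceil_pos.2 hp
  have hpn : p ≤ n := Nat.le_ceil p
  refine ⟨((n.factorial : ℝ≥0) * (4 / 3) ^ n) ^ (p / n), fun ξ ε a t hε ha hat htT => ?_⟩
  set f : Ω → ℝ≥0∞ := fun ω => volume (nearTimes X ξ ε ω ∩ Ioc a t) / ENNReal.ofReal (2 * ε)
  have hfm : Measurable f := ((hX.measurable_volume_nearTimes ξ ε).comp
    (g := fun q : (ℝ × ℝ) × Ω => volume (nearTimes X ξ ε q.2 ∩ Ioc q.1.1 q.1.2))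
    (f := fun ω : Ω => ((a, t), ω)) (by fun_prop)).div_const _
  have h0 : 0 ≤ t - a := sub_nonneg.2 hat
  have hmom : ∫⁻ ω, f ω ^ (n : ℝ) ∂P ≤ (n.factorial * (4 / 3) ^ n) *
      ENNReal.ofReal ((t - a) ^ (3 / 4 : ℝ)) ^ n := by
    have h := hX.setLIntegral_volume_pow_le ξ hε n a t ha hat htT ∅ (by simp)
    have huniv : nearEvent X ξ ε ∅ = univ := by simp [nearEvent]
    rw [huniv, setLIntegral_univ, measure_univ, mul_one] at h
    have hf : ∀ ω, f ω ^ (n : ℝ) = volume (nearTimes X ξ ε ω ∩ Ioc a t) ^ n *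
        ((ENNReal.ofReal (2 * ε))⁻¹) ^ n := fun ω => by
      rw [ENNReal.rpow_natCast, ← mul_pow]
      rfl
    simp_rw [hf]
    rw [lintegral_mul_const' _ _ (by simp [hε])]
    refine (mul_le_mul' h le_rfl).trans (le_of_eq ?_)
    rw [← ENNReal.ofReal_pow (by positivity),
      ← ENNReal.ofReal_inv_of_pos (by positivity), ← ENNReal.ofReal_pow (by positivity),
      ← ENNReal.ofReal_mul (by positivity)]
    have h43 : (4 / 3 : ℝ≥0∞) = ENNReal.ofReal (4 / 3) := by
      rw [ENNReal.ofReal_div_of_pos (by norm_num)]; simp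
    rw [h43, ← ENNReal.ofReal_pow (by positivity), ← ENNReal.ofReal_natCast,
      ← ENNReal.ofReal_mul (by positivity), ← ENNReal.ofReal_mul (by positivity)]
    congr 1
    rw [mul_assoc, ← mul_pow, mul_assoc (n.factorial : ℝ), ← mul_pow]
    congr 2
    field_simp
    ring
  have hJ : (∫⁻ ω, f ω ^ p ∂P) ^ (1 / p) ≤ (∫⁻ ω, f ω ^ (n : ℝ) ∂P) ^ (1 / (n : ℝ)) := by
    have := eLpNorm'_le_eLpNorm'_of_exponent_le (f := f) hp hpn P hfm.aestronglyMeasurable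
    simpa [eLpNorm'] using this
  calc ∫⁻ ω, f ω ^ p ∂P = ((∫⁻ ω, f ω ^ p ∂P) ^ (1 / p)) ^ p := by
        rw [← ENNReal.rpow_mul, one_div_mul_cancel hp.ne', ENNReal.rpow_one]
    _ ≤ (((n.factorial * (4 / 3) ^ n) *
          ENNReal.ofReal ((t - a) ^ (3 / 4 : ℝ)) ^ n) ^ (1 / (n : ℝ))) ^ p := by
        gcongr
        exact hJ.trans (by gcongr)
    _ = _ := by
        rw [← ENNReal.rpow_mul, ENNReal.mul_rpow_of_nonneg _ _ (by positivity),
          ← ENNReal.rpow_natCast (ENNReal.ofReal _), ← ENNReal.rpow_mul]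
        have hn' : (n : ℝ) ≠ 0 := by positivity
        have e1 : (n : ℝ) * (1 / n * p) = p := by field_simp
        have e2 : 1 / (n : ℝ) * p = p / n := by ring
        rw [e1, e2, ENNReal.coe_rpow_of_nonneg _ (by positivity)]
        push_cast
        norm_num

end IsNondeterministic

end StochasticHeat


namespace StochasticHeat

/-! ### A criterion for monotone functions to lie in a modular Besov space -/

/-- Both `x` and `x + s` lie in the interval of radius `h` about `x`, clamped to `[0, 1]`.
Monotonicity bounds the increment by that over the whole interval, so the supremum over shifts
disappears. -/
lemma lpModulus_le_of_monotoneOn {f : ℝ → ℝ} (hf : MonotoneOn f (Icc 0 1)) {p t h : ℝ} (hp : 0 < p)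
    (hth : t ≤ h) :
    lpModulus p (Icc 0 1) f t ≤ (∫⁻ x in Icc (0 : ℝ) 1,
      ENNReal.ofReal (f (min (x + h) 1) - f (max (x - h) 0)) ^ p) ^ (1 / p) := by
  refine iSup₂_le fun s hs => ENNReal.rpow_le_rpow ?_ (by positivity)
  have hsub : {x | x ∈ Icc (0 : ℝ) 1 ∧ x + s ∈ Icc (0 : ℝ) 1} ⊆ Icc 0 1 := fun x hx => hx.1
  have hmeas : MeasurableSet {x | x ∈ Icc (0 : ℝ) 1 ∧ x + s ∈ Icc (0 : ℝ) 1} :=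
    measurableSet_Icc.inter (measurableSet_Icc.preimage (by fun_prop))
  refine le_trans (lintegral_mono_ae ?_) (lintegral_mono_set hsub)
  filter_upwards [ae_restrict_mem hmeas] with x hx
  rw [← ENNReal.ofReal_rpow_of_nonneg (abs_nonneg _) hp.le]
  have hs' := abs_le.1 (hs.trans hth)
  have hh : 0 ≤ h := (abs_nonneg s).trans (hs.trans hth)
  obtain ⟨⟨h0, h1⟩, h2, h3⟩ := hx
  have hmin : min (x + h) 1 ∈ Icc (0 : ℝ) 1 := ⟨le_min (by linarith) (by norm_num), min_le_right _ _⟩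
  have hmax : max (x - h) 0 ∈ Icc (0 : ℝ) 1 := ⟨le_max_right _ _, max_le (by linarith) (by norm_num)⟩
  have key : ∀ y ∈ Icc (0 : ℝ) 1, x - h ≤ y → y ≤ x + h →
      f (max (x - h) 0) ≤ f y ∧ f y ≤ f (min (x + h) 1) := fun y hy hl hr =>
    ⟨hf hmax hy (max_le hl hy.1), hf hy hmin (le_min hr hy.2)⟩
  have k1 := key x ⟨h0, h1⟩ (by linarith) (by linarith)
  have k2 := key (x + s) ⟨h2, h3⟩ (by linarith [hs'.1]) (by linarith [hs'.2])
  refine ENNReal.rpow_le_rpow (ENNReal.ofReal_le_ofReal (abs_le.2 ⟨?_, ?_⟩)) hp.le <;> linarith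

/-- Here `j log 2 ≤ log(1/t)`, while the extra 1 in `j + 1` is absorbed by `1 ≤ log(1/t) /
log(1/t₀)`; this is where `t₀ < 1` enters the constant. -/
lemma dyadic_modulus_le_logModulus {α lam t₀ : ℝ} (hα : 0 ≤ α) (hlam : 0 ≤ lam)
    (ht₀ : t₀ ∈ Ioo (0 : ℝ) 1) {t : ℝ} (ht : t ∈ Ioc 0 t₀) {j : ℕ} (hj : (1 / 2 : ℝ) ^ (j + 1) < t)
    (hj' : t ≤ (1 / 2 : ℝ) ^ j) :
    ((1 / 2 : ℝ) ^ j) ^ α * ((j : ℝ) + 1) ^ lam ≤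
      2 ^ α * (1 / Real.log (1 / t₀) + 1 / Real.log 2) ^ lam * logModulus α lam t := by
  have hl0 : 0 < Real.log (1 / t₀) := Real.log_pos (one_lt_one_div ht₀.1 ht₀.2)
  have hl2 : 0 < Real.log 2 := Real.log_pos (by norm_num)
  have h1 : Real.log (1 / t₀) ≤ Real.log (1 / t) :=
    Real.log_le_log (by have := ht₀.1; positivity) (one_div_le_one_div_of_le ht.1 ht.2)
  have h2 : j * Real.log 2 ≤ Real.log (1 / t) := by
    rw [← Real.log_pow]
    refine Real.log_le_log (by positivity) ?_
    rw [le_one_div (by positivity) ht.1]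
    simpa using hj'
  have hlt : 0 ≤ Real.log (1 / t) := hl0.le.trans h1
  have h3 : (j : ℝ) + 1 ≤ (1 / Real.log (1 / t₀) + 1 / Real.log 2) * Real.log (1 / t) := by
    rw [add_mul, one_div_mul_eq_div, one_div_mul_eq_div, add_comm]
    exact add_le_add ((one_le_div hl0).2 h1) ((le_div_iff₀ hl2).2 h2)
  have h4 : (1 / 2 : ℝ) ^ j ≤ 2 * t := by rw [pow_succ] at hj; linarith
  calc ((1 / 2 : ℝ) ^ j) ^ α * ((j : ℝ) + 1) ^ lam
      ≤ (2 * t) ^ α * ((1 / Real.log (1 / t₀) + 1 / Real.log 2) * Real.log (1 / t)) ^ lam := by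
        have := ht.1.le
        exact mul_le_mul (Real.rpow_le_rpow (by positivity) h4 hα)
          (Real.rpow_le_rpow (by positivity) h3 hlam) (by positivity) (by positivity)
    _ = _ := by
        rw [Real.mul_rpow (by norm_num) ht.1.le, Real.mul_rpow (by positivity) hlt, logModulus]
        ring

theorem memModularBesov_of_monotoneOn {f : ℝ → ℝ} (hc : ContinuousOn f (Icc 0 1))
    (hf : MonotoneOn f (Icc 0 1)) {α lam p : ℝ} (hα : 0 ≤ α) (hlam : 0 ≤ lam) (hp : 0 < p)
    {M : ℝ≥0∞} (hM : M ≠ ∞)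
    (h : ∀ j : ℕ, ∫⁻ x in Icc (0 : ℝ) 1,
      ENNReal.ofReal (f (min (x + (1 / 2) ^ j) 1) - f (max (x - (1 / 2) ^ j) 0)) ^ p ≤
        M * ENNReal.ofReal (((1 / 2 : ℝ) ^ j) ^ α * ((j : ℝ) + 1) ^ lam) ^ p) :
    MemModularBesov (logModulus α lam) p (Icc 0 1) f := by
  have hmem : MemLp f (ENNReal.ofReal p) (volume.restrict (Icc 0 1)) := by
    obtain ⟨C, hC⟩ := isCompact_Icc.exists_bound_of_continuousOn hc
    exact MemLp.of_bound (hc.aestronglyMeasurable measurableSet_Icc) C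
      ((ae_restrict_mem measurableSet_Icc).mono hC)
  refine ⟨hmem, fun t₀ ht₀ => ENNReal.add_lt_top.2 ⟨hmem.eLpNorm_lt_top, ?_⟩⟩
  set c : ℝ := 2 ^ α * (1 / Real.log (1 / t₀) + 1 / Real.log 2) ^ lam
  refine (iSup₂_le fun t ht => ?_).trans_lt
    (ENNReal.mul_lt_top (ENNReal.rpow_lt_top_of_nonneg (by positivity : 0 ≤ 1 / p) hM)
      (ENNReal.ofReal_lt_top (r := c)))
  obtain ⟨j, hj, hj'⟩ := exists_nat_pow_near_of_lt_one ht.1 (ht.2.trans ht₀.2.le)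
    (by norm_num : (0 : ℝ) < 1 / 2) (by norm_num)
  have hl0 : 0 < Real.log (1 / t₀) := Real.log_pos (one_lt_one_div ht₀.1 ht₀.2)
  have hl2 : 0 < Real.log 2 := Real.log_pos (by norm_num)
  have hcpos : 0 ≤ c := by positivity
  refine ENNReal.div_le_of_le_mul ?_
  calc lpModulus p (Icc 0 1) f t
      ≤ (M * ENNReal.ofReal (((1 / 2 : ℝ) ^ j) ^ α * ((j : ℝ) + 1) ^ lam) ^ p) ^ (1 / p) :=
        (lpModulus_le_of_monotoneOn hf hp hj').trans
          (ENNReal.rpow_le_rpow (h j) (by positivity))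
    _ = M ^ (1 / p) * ENNReal.ofReal (((1 / 2 : ℝ) ^ j) ^ α * ((j : ℝ) + 1) ^ lam) := by
        rw [ENNReal.mul_rpow_of_nonneg _ _ (by positivity), ← ENNReal.rpow_mul,
          mul_one_div_cancel hp.ne', ENNReal.rpow_one]
    _ ≤ M ^ (1 / p) * ENNReal.ofReal (c * logModulus α lam t) := by
        exact mul_le_mul_right (ENNReal.ofReal_le_ofReal
          (dyadic_modulus_le_logModulus hα hlam ht₀ ht hj hj')) _
    _ = M ^ (1 / p) * ENNReal.ofReal c * ENNReal.ofReal (logModulus α lam t) := by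
        rw [ENNReal.ofReal_mul hcpos, mul_assoc]

/-! ### Increments of local times -/

lemma Continuous.integrableOn_ball {D : ℝ → ℝ} (hD : Continuous D) (ξ ε : ℝ) :
    IntegrableOn D (Metric.ball ξ ε) :=
  (hD.integrableOn_Icc (a := ξ - ε) (b := ξ + ε)).mono_set (by
    rw [Real.ball_eq_Ioo]; exact Ioo_subset_Icc_self)

lemma tendsto_average_ball {D : ℝ → ℝ} (hD : Continuous D) (ξ : ℝ) :
    Tendsto (fun ε : ℝ => (∫ η in Metric.ball ξ ε, D η) / (2 * ε)) (𝓝[>] 0) (𝓝 (D ξ)) := by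
  rw [Metric.tendsto_nhdsWithin_nhds]
  intro δ hδ
  obtain ⟨ρ, hρ, hball⟩ := Metric.continuous_iff.1 hD ξ (δ / 2) (by positivity)
  refine ⟨ρ, hρ, fun {ε} hε hερ => ?_⟩
  have hε0 : 0 < ε := hε
  rw [Real.dist_eq, sub_zero, abs_of_pos hε0] at hερ
  have hvol : volume.real (Metric.ball ξ ε) = 2 * ε := by
    rw [Measure.real, Real.volume_ball, ENNReal.toReal_ofReal (by positivity)]
  have h1 : (∫ η in Metric.ball ξ ε, D η) / (2 * ε) - D ξ =
      (∫ η in Metric.ball ξ ε, (D η - D ξ)) / (2 * ε) := by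
    rw [integral_sub (Continuous.integrableOn_ball hD ξ ε)
      (integrableOn_const measure_ball_lt_top.ne), setIntegral_const, hvol, smul_eq_mul]
    field_simp
  have h2 : ‖∫ η in Metric.ball ξ ε, (D η - D ξ)‖ ≤ δ / 2 * volume.real (Metric.ball ξ ε) :=
    norm_setIntegral_le_of_norm_le_const measure_ball_lt_top fun η hη =>
      (hball η ((Metric.mem_ball.1 hη).trans hερ)).le
  rw [Real.dist_eq, h1, abs_div, abs_of_pos (by positivity : 0 < 2 * ε)]
  rw [hvol, Real.norm_eq_abs] at h2
  calc _ ≤ δ / 2 := (div_le_iff₀ (by positivity)).2 h2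
    _ < δ := by linarith

lemma tendsto_one_div_add_atTop_nhdsGT_zero :
    Tendsto (fun m : ℕ => 1 / ((m : ℝ) + 1)) atTop (𝓝[>] 0) :=
  tendsto_nhdsWithin_iff.2 ⟨tendsto_one_div_add_atTop_nhds_zero_nat,
    Eventually.of_forall fun _ => mem_Ioi.2 Nat.one_div_pos_of_nat⟩

namespace IsJointlyContinuousLocalTime

variable {T : ℝ} {θ Y : ℝ → ℝ} {L : ℝ → ℝ → ℝ}

lemma continuous_left (hL : IsJointlyContinuousLocalTime T θ L) {t : ℝ} (ht : t ∈ Icc 0 T) :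
    Continuous fun ξ => L ξ t := by
  have := hL.2.comp (f := fun ξ : ℝ => (ξ, t)) (s := univ) (by fun_prop) fun ξ _ => ⟨mem_univ _, ht⟩
  exact continuousOn_univ.1 this

lemma continuousOn_right (hL : IsJointlyContinuousLocalTime T θ L) (ξ : ℝ) :
    ContinuousOn (fun t => L ξ t) (Icc 0 T) :=
  hL.2.comp (f := fun t : ℝ => (ξ, t)) (by fun_prop) fun _ ht => ⟨mem_univ _, ht⟩

lemma volume_preimage_inter_Icc (hL : IsJointlyContinuousLocalTime T θ L)
    (hθ : ∀ᵐ t ∂volume.restrict (Icc 0 T), θ t = Y t) {t : ℝ} (ht : t ∈ Icc 0 T) (ξ ε : ℝ) :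
    volume (Y ⁻¹' Metric.ball ξ ε ∩ Icc 0 t) =
      ENNReal.ofReal (∫ η in Metric.ball ξ ε, L η t) := by
  have hint := Continuous.integrableOn_ball (hL.continuous_left ht) ξ ε
  rw [ofReal_integral_eq_lintegral_ofReal hint (ae_of_all _ (hL.1 t ht).1),
    ← (hL.1 t ht).2 _ measurableSet_ball]
  refine measure_congr ?_
  filter_upwards [(ae_restrict_iff' measurableSet_Icc).1 hθ] with s hs
  refine propext ?_
  change (Y s ∈ Metric.ball ξ ε ∧ s ∈ Icc 0 t) ↔ (s ∈ Icc 0 t ∧ θ s ∈ Metric.ball ξ ε)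
  rw [and_comm]
  refine and_congr_right fun h => ?_
  rw [hs ⟨h.1, h.2.trans ht.2⟩]

lemma volume_preimage_inter_Ioc (hL : IsJointlyContinuousLocalTime T θ L) (hY : Measurable Y)
    (hθ : ∀ᵐ t ∂volume.restrict (Icc 0 T), θ t = Y t) {a t : ℝ} (ha : 0 ≤ a) (hat : a ≤ t)
    (htT : t ≤ T) (ξ ε : ℝ) :
    volume.real (Y ⁻¹' Metric.ball ξ ε ∩ Ioc a t) =
      ∫ η in Metric.ball ξ ε, (L η t - L η a) := by
  have ht : t ∈ Icc 0 T := ⟨ha.trans hat, htT⟩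
  have ha' : a ∈ Icc 0 T := ⟨ha, hat.trans htT⟩
  have hint : ∀ s ∈ Icc 0 T, IntegrableOn (fun η => L η s) (Metric.ball ξ ε) := fun s hs =>
    Continuous.integrableOn_ball (hL.continuous_left hs) ξ ε
  have hpos : ∀ s ∈ Icc 0 T, 0 ≤ ∫ η in Metric.ball ξ ε, L η s := fun s hs =>
    integral_nonneg (hL.1 s hs).1
  have hv : ∀ s ∈ Icc 0 T, volume.real (Y ⁻¹' Metric.ball ξ ε ∩ Icc 0 s) =
      ∫ η in Metric.ball ξ ε, L η s := fun s hs => by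
    rw [Measure.real, hL.volume_preimage_inter_Icc hθ hs, ENNReal.toReal_ofReal (hpos s hs)]
  rw [integral_sub (hint t ht) (hint a ha'), ← hv t ht, ← hv a ha', eq_sub_iff_add_eq']
  have hfin : ∀ I : Set ℝ, volume I ≠ ∞ → volume (Y ⁻¹' Metric.ball ξ ε ∩ I) ≠ ∞ := fun I hI =>
    measure_ne_top_of_subset inter_subset_right hI
  rw [← measureReal_union ?_ ?_ (hfin _ (by simp)) (hfin _ (by simp))]
  · rw [← inter_union_distrib_left, Icc_union_Ioc_eq_Icc ha hat]
  · exact (disjoint_left.2 fun r h1 h2 => absurd h1.2 (not_le.2 h2.1)).mono inter_subset_right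
      inter_subset_right
  · exact (hY measurableSet_ball).inter measurableSet_Ioc

/-- Continuity in the space variable recovers the increment at every `ξ`, not just almost every one,
from occupation times of the measurable version `Y`. -/
lemma tendsto_average (hL : IsJointlyContinuousLocalTime T θ L) (hY : Measurable Y)
    (hθ : ∀ᵐ t ∂volume.restrict (Icc 0 T), θ t = Y t) {a t : ℝ} (ha : 0 ≤ a) (hat : a ≤ t)
    (htT : t ≤ T) (ξ : ℝ) :
    Tendsto (fun ε : ℝ => volume.real (Y ⁻¹' Metric.ball ξ ε ∩ Ioc a t) / (2 * ε)) (𝓝[>] 0)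
      (𝓝 (L ξ t - L ξ a)) := by
  have ht : t ∈ Icc 0 T := ⟨ha.trans hat, htT⟩
  have ha' : a ∈ Icc 0 T := ⟨ha, hat.trans htT⟩
  have hD : Continuous fun η => L η t - L η a :=
    (hL.continuous_left ht).sub (hL.continuous_left ha')
  simp_rw [hL.volume_preimage_inter_Ioc hY hθ ha hat htT]
  exact tendsto_average_ball hD ξ

lemma monotoneOn (hL : IsJointlyContinuousLocalTime T θ L) (hY : Measurable Y)
    (hθ : ∀ᵐ t ∂volume.restrict (Icc 0 T), θ t = Y t) (ξ : ℝ) :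
    MonotoneOn (fun t => L ξ t) (Icc 0 T) := by
  intro a ha t ht hat
  refine sub_nonneg.1 (ge_of_tendsto (hL.tendsto_average hY hθ ha.1 hat ht.2 ξ) ?_)
  filter_upwards [self_mem_nhdsWithin] with ε hε
  exact div_nonneg measureReal_nonneg (mul_nonneg (by norm_num) (le_of_lt hε))

lemma tendsto_average_ofReal (hL : IsJointlyContinuousLocalTime T θ L) (hY : Measurable Y)
    (hθ : ∀ᵐ t ∂volume.restrict (Icc 0 T), θ t = Y t) {a t : ℝ} (ha : 0 ≤ a) (hat : a ≤ t)
    (htT : t ≤ T) (ξ : ℝ) :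
    Tendsto (fun m : ℕ => volume (Y ⁻¹' Metric.ball ξ (1 / ((m : ℝ) + 1)) ∩ Ioc a t) /
      ENNReal.ofReal (2 * (1 / ((m : ℝ) + 1)))) atTop (𝓝 (ENNReal.ofReal (L ξ t - L ξ a))) := by
  refine (ENNReal.tendsto_ofReal ((hL.tendsto_average hY hθ ha hat htT ξ).comp
    tendsto_one_div_add_atTop_nhdsGT_zero)).congr fun m => ?_
  have hm : (0 : ℝ) < 1 / ((m : ℝ) + 1) := Nat.one_div_pos_of_nat
  rw [Function.comp_apply, ENNReal.ofReal_div_of_pos (by positivity), Measure.real,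
    ENNReal.ofReal_toReal ((measure_mono inter_subset_right).trans_lt (by simp)).ne]

end IsJointlyContinuousLocalTime

/-! ### Besov regularity of the local time in time -/

namespace IsNondeterministic

variable {Ω : Type*}

lemma nearTimes_eq_preimage (X : ℝ → Ω → ℝ) (ξ ε : ℝ) (ω : Ω) :
    nearTimes X ξ ε ω = (fun t => X t ω) ⁻¹' Metric.ball ξ ε := by
  ext t
  simp [nearTimes, Real.dist_eq]

variable [MeasurableSpace Ω] {P : Measure Ω} {T : ℝ} {S : Set ℝ} {X : ℝ → Ω → ℝ}

/-- The `p`-th power integral of the symmetric increments of length `h` of the approximate local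
time at `ξ`, at the scale `ε`. -/
noncomputable def incrementEnergy (X : ℝ → Ω → ℝ) (p ξ h ε : ℝ) (ω : Ω) : ℝ≥0∞ :=
  ∫⁻ x in Icc (0 : ℝ) 1, (volume (nearTimes X ξ ε ω ∩ Ioc (max (x - h) 0) (min (x + h) 1)) /
    ENNReal.ofReal (2 * ε)) ^ p

lemma measurable_incrementEnergy_integrand (hX : IsNondeterministic P T S X) (p ξ h ε : ℝ) :
    Measurable fun q : Ω × ℝ =>
      (volume (nearTimes X ξ ε q.1 ∩ Ioc (max (q.2 - h) 0) (min (q.2 + h) 1)) /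
        ENNReal.ofReal (2 * ε)) ^ p := by
  have := (hX.measurable_volume_nearTimes ξ ε).comp
    (g := fun q : (ℝ × ℝ) × Ω => volume (nearTimes X ξ ε q.2 ∩ Ioc q.1.1 q.1.2))
    (f := fun q : Ω × ℝ => ((max (q.2 - h) 0, min (q.2 + h) 1), q.1)) (by fun_prop)
  exact (this.div_const _).pow_const p

lemma measurable_incrementEnergy_integrand_right (hX : IsNondeterministic P T S X)
    (p ξ h ε : ℝ) (ω : Ω) :
    Measurable fun x : ℝ =>
      (volume (nearTimes X ξ ε ω ∩ Ioc (max (x - h) 0) (min (x + h) 1)) /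
        ENNReal.ofReal (2 * ε)) ^ p := by
  have := (hX.measurable_volume_nearTimes ξ ε).comp
    (g := fun q : (ℝ × ℝ) × Ω => volume (nearTimes X ξ ε q.2 ∩ Ioc q.1.1 q.1.2))
    (f := fun x : ℝ => ((max (x - h) 0, min (x + h) 1), ω)) (by fun_prop)
  exact (this.div_const _).pow_const p

lemma measurable_incrementEnergy (hX : IsNondeterministic P T S X) (p ξ h ε : ℝ) :
    Measurable (incrementEnergy X p ξ h ε) :=
  (hX.measurable_incrementEnergy_integrand p ξ h ε).lintegral_prod_right'

lemma exists_lintegral_incrementEnergy_le [IsProbabilityMeasure P]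
    (hX : IsNondeterministic P T S X) (hT : 1 ≤ T) {p : ℝ} (hp : 0 < p) :
    ∃ C : ℝ≥0, ∀ (ξ ε h : ℝ), 0 < ε → 0 ≤ h →
      ∫⁻ ω, incrementEnergy X p ξ h ε ω ∂P ≤ C * ENNReal.ofReal ((2 * h) ^ (3 / 4 : ℝ)) ^ p := by
  obtain ⟨C, hC⟩ := hX.exists_lintegral_volume_rpow_le hp
  refine ⟨C, fun ξ ε h hε hh => ?_⟩
  unfold incrementEnergy
  rw [lintegral_lintegral_swap (hX.measurable_incrementEnergy_integrand p ξ h ε).aemeasurable]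
  calc _ ≤ ∫⁻ x in Icc (0 : ℝ) 1, C * ENNReal.ofReal ((2 * h) ^ (3 / 4 : ℝ)) ^ p := by
        refine setLIntegral_mono measurable_const fun x hx => ?_
        have h1 : max (x - h) 0 ≤ min (x + h) 1 :=
          max_le (le_min (by linarith) (by linarith [hx.2]))
            (le_min (by linarith [hx.1]) (by norm_num))
        refine (hC ξ ε _ _ hε (le_max_right _ _) h1 ((min_le_right _ _).trans hT)).trans ?_
        have h2 : min (x + h) 1 - max (x - h) 0 ≤ 2 * h := by
          linarith [min_le_left (x + h) 1, le_max_left (x - h) 0]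
        have h3 := sub_nonneg.2 h1
        gcongr
    _ = _ := by simp

/-- After division by the weights, the expectations are of order `(j + 1)^(-λp)`, summable because
`λp > 1`. The random constant `M` is the sum of the weighted energies itself, finite almost surely.
-/
lemma ae_exists_liminf_incrementEnergy_le [IsProbabilityMeasure P]
    (hX : IsNondeterministic P T S X) (hT : 1 ≤ T) {lam p : ℝ} (hp : 0 < p) (hlp : 1 < lam * p)
    (ξ : ℝ) :
    ∀ᵐ ω ∂P, ∃ M : ℝ≥0∞, M ≠ ∞ ∧ ∀ j : ℕ,
      liminf (fun m : ℕ => incrementEnergy X p ξ ((1 / 2) ^ j) (1 / ((m : ℝ) + 1)) ω) atTop ≤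
        M * ENNReal.ofReal (((1 / 2 : ℝ) ^ j) ^ (3 / 4 : ℝ) * ((j : ℝ) + 1) ^ lam) ^ p := by
  obtain ⟨C, hC⟩ := hX.exists_lintegral_incrementEnergy_le hT hp
  set w : ℕ → ℝ≥0∞ := fun j =>
    ENNReal.ofReal (((1 / 2 : ℝ) ^ j) ^ (3 / 4 : ℝ) * ((j : ℝ) + 1) ^ lam) ^ p
  have hw0 : ∀ j, w j ≠ 0 := fun j => by
    refine (ENNReal.rpow_pos (ENNReal.ofReal_pos.2 (by positivity)) ENNReal.ofReal_ne_top).ne'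
  have hwt : ∀ j, w j ≠ ∞ := fun j => ENNReal.rpow_ne_top_of_nonneg hp.le ENNReal.ofReal_ne_top
  set F : ℕ → Ω → ℝ≥0∞ := fun j ω =>
    liminf (fun m : ℕ => incrementEnergy X p ξ ((1 / 2) ^ j) (1 / ((m : ℝ) + 1)) ω) atTop
  have hFm : ∀ j, Measurable (F j) := fun j =>
    Measurable.liminf fun m => hX.measurable_incrementEnergy p ξ _ _
  -- Fatou's lemma over `Ω`: the energy bound is uniform in the radius `1 / (m + 1)`.
  have hF : ∀ j, ∫⁻ ω, F j ω ∂P ≤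
      C * ENNReal.ofReal ((2 * (1 / 2 : ℝ) ^ j) ^ (3 / 4 : ℝ)) ^ p := fun j =>
    (lintegral_liminf_le fun m => hX.measurable_incrementEnergy p ξ _ _).trans
      (liminf_le_of_le (by isBoundedDefault) fun b hb => by
        obtain ⟨m, hm⟩ := hb.exists
        exact hm.trans (hC ξ _ _ Nat.one_div_pos_of_nat (by positivity)))
  have hsum : ∫⁻ ω, ∑' j, F j ω / w j ∂P < ∞ := by
    rw [lintegral_tsum fun j => ((hFm j).div_const _).aemeasurable]
    have hterm : ∀ j, ∫⁻ ω, F j ω / w j ∂P ≤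
        C * ENNReal.ofReal (2 ^ (3 / 4 : ℝ)) ^ p *
          ENNReal.ofReal (((j : ℝ) + 1) ^ (-(lam * p))) := fun j => by
      have hdiv : ∀ ω, F j ω / w j = F j ω * (w j)⁻¹ := fun _ => rfl
      simp_rw [hdiv]
      rw [lintegral_mul_const _ (hFm j), ← div_eq_mul_inv]
      refine ENNReal.div_le_of_le_mul ((hF j).trans (le_of_eq ?_))
      have hj : (0 : ℝ) < (j : ℝ) + 1 := by positivity
      have h1 : ENNReal.ofReal (((j : ℝ) + 1) ^ (-(lam * p))) *
          ENNReal.ofReal (((j : ℝ) + 1) ^ lam) ^ p = 1 := by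
        rw [ENNReal.ofReal_rpow_of_nonneg (by positivity) hp.le, ← Real.rpow_mul hj.le,
          ← ENNReal.ofReal_mul (by positivity), ← Real.rpow_add hj, neg_add_cancel,
          Real.rpow_zero, ENNReal.ofReal_one]
      simp only [w]
      rw [Real.mul_rpow (by norm_num) (by positivity), ENNReal.ofReal_mul (by positivity),
        ENNReal.ofReal_mul (by positivity), ENNReal.mul_rpow_of_nonneg _ _ hp.le,
        ENNReal.mul_rpow_of_nonneg _ _ hp.le]
      calc _ = C * ENNReal.ofReal (2 ^ (3 / 4 : ℝ)) ^ p *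
            ENNReal.ofReal (((1 / 2 : ℝ) ^ j) ^ (3 / 4 : ℝ)) ^ p * 1 := by ring
        _ = _ := by rw [← h1]; ring
    refine (ENNReal.tsum_le_tsum hterm).trans_lt ?_
    rw [ENNReal.tsum_mul_left]
    refine ENNReal.mul_lt_top (ENNReal.mul_lt_top ENNReal.coe_lt_top
      (ENNReal.rpow_lt_top_of_nonneg hp.le ENNReal.ofReal_ne_top)) ?_
    have hs : Summable fun j : ℕ => ((j : ℝ) + 1) ^ (-(lam * p)) := by
      have := (summable_nat_add_iff 1).2 (Real.summable_nat_rpow.2 (by linarith : -(lam * p) < -1))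
      simpa using this
    exact hs.tsum_ofReal_lt_top
  filter_upwards [ae_lt_top (Measurable.tsum fun j => (hFm j).div_const _) hsum.ne]
    with ω hω
  refine ⟨_, hω.ne, fun j => ?_⟩
  rw [← ENNReal.div_le_iff (hw0 j) (hwt j)]
  exact ENNReal.le_tsum j

/-- The exceptional set does not depend on `L`, because the increments of every continuous local
time are limits of the same occupation quotients of `X`. -/
theorem ae_memModularBesov [IsProbabilityMeasure P] (hX : IsNondeterministic P T S X)
    (hT : 1 ≤ T) {θ : ℝ → Ω → ℝ}
    (hθ : ∀ᵐ ω ∂P, ∀ᵐ t ∂volume.restrict (Icc 0 T), θ t ω = X t ω) {lam p : ℝ}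
    (hlam : 0 < lam) (hp : 1 / lam < p) (ξ : ℝ) :
    ∀ᵐ ω ∂P, ∀ L : ℝ → ℝ → ℝ, IsJointlyContinuousLocalTime T (fun t => θ t ω) L →
      MemModularBesov (logModulus (3 / 4) lam) p (Icc 0 1) (fun t => L ξ t) := by
  have hp0 : 0 < p := (one_div_pos.2 hlam).trans hp
  have hlp : 1 < lam * p := by rwa [div_lt_iff₀ hlam, mul_comm] at hp
  filter_upwards [hθ, hX.ae_exists_liminf_incrementEnergy_le hT hp0 hlp ξ] with ω hω hM L hL
  obtain ⟨M, hM, hMj⟩ := hM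
  have hY : Measurable fun t => X t ω := hX.measurable.comp (measurable_id.prodMk measurable_const)
  have hsub : Icc (0 : ℝ) 1 ⊆ Icc 0 T := Icc_subset_Icc_right hT
  refine memModularBesov_of_monotoneOn ((hL.continuousOn_right ξ).mono hsub)
    ((hL.monotoneOn hY hω ξ).mono hsub) (by norm_num) hlam.le hp0 hM fun j => le_trans ?_ (hMj j)
  set h : ℝ := (1 / 2) ^ j
  have hh : 0 ≤ h := by positivity
  calc ∫⁻ x in Icc (0 : ℝ) 1, ENNReal.ofReal (L ξ (min (x + h) 1) - L ξ (max (x - h) 0)) ^ p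
      = ∫⁻ x in Icc (0 : ℝ) 1, liminf (fun m : ℕ =>
          (volume (nearTimes X ξ (1 / ((m : ℝ) + 1)) ω ∩
            Ioc (max (x - h) 0) (min (x + h) 1)) /
              ENNReal.ofReal (2 * (1 / ((m : ℝ) + 1)))) ^ p) atTop := by
        refine setLIntegral_congr_fun measurableSet_Icc fun x hx => ?_
        have h1 : max (x - h) 0 ≤ min (x + h) 1 :=
          max_le (le_min (by linarith) (by linarith [hx.2]))
            (le_min (by linarith [hx.1]) (by norm_num))
        have hlim := hL.tendsto_average_ofReal hY hω (le_max_right (x - h) 0) h1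
          ((min_le_right _ _).trans hT) ξ
        simp_rw [nearTimes_eq_preimage]
        exact (((ENNReal.continuous_rpow_const (y := p)).tendsto _).comp hlim).liminf_eq.symm
    _ ≤ _ := by
        -- A second use of Fatou's lemma, now in the time variable and for a fixed path.
        simp only [incrementEnergy]
        exact lintegral_liminf_le fun m =>
          hX.measurable_incrementEnergy_integrand_right p ξ h (1 / ((m : ℝ) + 1)) ω

end IsNondeterministic

end StochasticHeat


namespace StochasticHeat

/-! ### Densities of measures with integrable characteristic function -/

open scoped FourierTransform SchwartzMap

/-- Fourier inversion in weak form, from two uses of the multiplication formula: one pairs `φ` with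
the characteristic function over Lebesgue measure, the other pairs `μ` with the inverse transform of
`φ`. The substitution `v ↦ -v` reconciles the sign conventions. -/
lemma integral_schwartzMap_eq {μ : Measure ℝ} [IsFiniteMeasure μ]
    (h : Integrable fun v : ℝ => charFun μ (2 * Real.pi * v)) (φ : 𝓢(ℝ, ℂ)) :
    ∫ x, φ x ∂μ = ∫ x, φ x * 𝓕 (fun v : ℝ => charFun μ (2 * Real.pi * v)) x := by
  have h1 : ∫ v, charFun μ (2 * Real.pi * v) * 𝓕 (φ : ℝ → ℂ) v =
      ∫ x, φ x * 𝓕 (fun v : ℝ => charFun μ (2 * Real.pi * v)) x := by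
    have := VectorFourier.integral_fourierIntegral_smul_eq_flip (L := innerₗ ℝ)
      (μ := volume) (ν := volume) Real.continuous_fourierChar continuous_inner φ.integrable h
    simp only [flip_innerₗ, smul_eq_mul] at this
    refine Eq.trans ?_ this
    refine integral_congr_ae (ae_of_all _ fun v => ?_)
    simp only [mul_comm (charFun μ _)]
    rfl
  have h2 : ∀ v, VectorFourier.fourierIntegral Real.fourierChar μ (innerₗ ℝ) (1 : ℝ → ℂ) v =
      charFun μ (2 * Real.pi * -v) := fun v => by
    rw [charFun_eq_fourierIntegral']
    congr 1
    rw [smul_eq_mul]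
    field_simp
  have h3 := VectorFourier.integral_fourierIntegral_smul_eq_flip (L := innerₗ ℝ)
      (μ := μ) (ν := volume) (f := (1 : ℝ → ℂ)) (g := ((𝓕⁻ φ : 𝓢(ℝ, ℂ)) : ℝ → ℂ))
      Real.continuous_fourierChar continuous_inner (integrable_const 1)
      (SchwartzMap.integrable _)
  have h4 : ∀ x, VectorFourier.fourierIntegral Real.fourierChar volume (innerₗ ℝ).flip
      ((𝓕⁻ φ : 𝓢(ℝ, ℂ)) : ℝ → ℂ) x = φ x := fun x => by
    rw [flip_innerₗ]
    change 𝓕 ((𝓕⁻ φ : 𝓢(ℝ, ℂ)) : ℝ → ℂ) x = φ x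
    rw [← SchwartzMap.fourier_coe, FourierTransform.fourier_fourierInv_eq]
  simp only [h2, h4, Pi.one_apply, smul_eq_mul, one_mul] at h3
  rw [← h3, ← h1, ← integral_neg_eq_self]
  refine integral_congr_ae (ae_of_all _ fun v => ?_)
  simp only [neg_neg]
  congr 1
  rw [SchwartzMap.fourierInv_coe, Real.fourierInv_eq_fourier_neg, neg_neg]

lemma tendsto_contDiffBump_indicator (c : ℝ) {r : ℝ} (hr : 0 < r) :
    ∃ φ : ℕ → ContDiffBump c, (∀ n, (φ n).rOut = r) ∧
      ∀ x, Tendsto (fun n => φ n x) atTop (𝓝 ((Metric.ball c r).indicator 1 x)) := by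
  have hlt : ∀ n : ℕ, r * (1 - 1 / ((n : ℝ) + 2)) < r := fun n => by
    have : (0 : ℝ) < 1 / ((n : ℝ) + 2) := by positivity
    nlinarith
  have hpos : ∀ n : ℕ, 0 < r * (1 - 1 / ((n : ℝ) + 2)) := fun n => by
    refine mul_pos hr (sub_pos.2 ((div_lt_one (by positivity)).2 ?_))
    have : (0 : ℝ) ≤ n := n.cast_nonneg
    linarith
  -- The inner radii increase to `r`; the shift by 2 keeps the first one positive.
  refine ⟨fun n => ⟨r * (1 - 1 / ((n : ℝ) + 2)), r, hpos n, hlt n⟩, fun n => rfl, fun x => ?_⟩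
  by_cases hx : x ∈ Metric.ball c r
  · rw [indicator_of_mem hx]
    have hlim : Tendsto (fun n : ℕ => r * (1 - 1 / ((n : ℝ) + 2))) atTop (𝓝 r) := by
      have : Tendsto (fun n : ℕ => 1 / ((n : ℝ) + 2)) atTop (𝓝 0) := by
        have := (tendsto_const_nhds (x := (1 : ℝ))).div_atTop
          (tendsto_atTop_add_const_right atTop (2 : ℝ) tendsto_natCast_atTop_atTop)
        exact this
      simpa using (this.const_sub 1).const_mul r
    refine tendsto_const_nhds.congr' ?_
    filter_upwards [hlim.eventually (lt_mem_nhds (Metric.mem_ball.1 hx))] with n hn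
    exact (ContDiffBump.one_of_mem_closedBall _ (Metric.mem_closedBall.2 hn.le)).symm
  · rw [indicator_of_notMem hx]
    refine tendsto_const_nhds.congr fun n => ?_
    exact (ContDiffBump.zero_of_le_dist _ (not_lt.1 hx)).symm

/-- A finite measure on `ℝ` with integrable characteristic function has a continuous density. -/
theorem exists_continuous_density {μ : Measure ℝ} [IsFiniteMeasure μ]
    (h : Integrable fun v : ℝ => charFun μ (2 * Real.pi * v)) :
    ∃ f : ℝ → ℝ, Continuous f ∧ (∀ x, 0 ≤ f x) ∧
      (∀ x, f x ≤ ∫ v, ‖charFun μ (2 * Real.pi * v)‖) ∧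
      μ = volume.withDensity fun x => ENNReal.ofReal (f x) := by
  set F : ℝ → ℂ := 𝓕 (fun v : ℝ => charFun μ (2 * Real.pi * v))
  have hF : Continuous F := VectorFourier.fourierIntegral_continuous Real.continuous_fourierChar
    continuous_inner h
  have hFle : ∀ x, ‖F x‖ ≤ ∫ v, ‖charFun μ (2 * Real.pi * v)‖ := fun x =>
    VectorFourier.norm_fourierIntegral_le_integral_norm _ _ _ _ _
  set f : ℝ → ℝ := fun x => (F x).re
  have hf : Continuous f := Complex.continuous_re.comp hF
  -- The weak inversion formula is tested on smooth bumps that converge to the indicator of the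
  -- ball.
  have hball : ∀ c r : ℝ, 0 < r → μ.real (Metric.ball c r) = ∫ x in Metric.ball c r, f x := by
    intro c r hr
    obtain ⟨φ, hφr, hφ⟩ := tendsto_contDiffBump_indicator c hr
    have hφeq : ∀ n, ∫ x, φ n x ∂μ = ∫ x, φ n x * f x := by
      intro n
      have hs : HasCompactSupport fun x => (φ n x : ℂ) :=
        (φ n).hasCompactSupport.comp_left (g := fun y : ℝ => (y : ℂ)) (by simp)
      have hd : ContDiff ℝ (⊤ : ℕ∞) fun x => (φ n x : ℂ) :=
        Complex.ofRealCLM.contDiff.comp (φ n).contDiff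
      have := integral_schwartzMap_eq h (hs.toSchwartzMap hd)
      change ∫ x, (φ n x : ℂ) ∂μ = ∫ x, (φ n x : ℂ) * F x at this
      rw [integral_complex_ofReal] at this
      have hre := congrArg Complex.re this
      rw [Complex.ofReal_re] at hre
      rw [hre, ← RCLike.re_eq_complex_re, ← integral_re]
      · simp [f]
      · refine Continuous.integrable_of_hasCompactSupport ?_ hs.mul_right
        exact (Complex.continuous_ofReal.comp (φ n).continuous).mul hF
    have h1 : Tendsto (fun n => ∫ x, φ n x ∂μ) atTop (𝓝 (μ.real (Metric.ball c r))) := by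
      rw [← integral_indicator_one measurableSet_ball]
      refine tendsto_integral_of_dominated_convergence (fun _ => 1)
        (fun n => (φ n).continuous.aestronglyMeasurable) (integrable_const _)
        (fun n => ae_of_all _ fun x => ?_) (ae_of_all _ hφ)
      rw [Real.norm_eq_abs, abs_of_nonneg (φ n).nonneg]
      exact (φ n).le_one
    have h2 : Tendsto (fun n => ∫ x, φ n x * f x) atTop (𝓝 (∫ x in Metric.ball c r, f x)) := by
      rw [← integral_indicator measurableSet_ball]
      have hint : Integrable ((Metric.ball c r).indicator fun x => ‖f x‖) := by
        rw [integrable_indicator_iff measurableSet_ball]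
        exact Continuous.integrableOn_ball hf.norm c r
      refine tendsto_integral_of_dominated_convergence _
        (fun n => ((φ n).continuous.mul hf).aestronglyMeasurable) hint
        (fun n => ae_of_all _ fun x => ?_) (ae_of_all _ fun x => ?_)
      · by_cases hx : x ∈ Metric.ball c r
        · rw [indicator_of_mem hx, norm_mul, Real.norm_eq_abs (φ n x), abs_of_nonneg (φ n).nonneg]
          exact mul_le_of_le_one_left (norm_nonneg _) (φ n).le_one
        · have : φ n x = 0 := (φ n).zero_of_le_dist (by rw [hφr]; exact not_lt.1 hx)
          simp [this, indicator_of_notMem hx]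
      · have := (hφ x).mul_const (f x)
        convert this using 2
        by_cases hx : x ∈ Metric.ball c r <;> simp [hx, indicator]
    simp_rw [hφeq] at h1
    exact tendsto_nhds_unique h1 h2
  -- A negative value would persist on a small ball by continuity and give it negative mass.
  have hf0 : ∀ x, 0 ≤ f x := by
    intro x
    by_contra hx
    obtain ⟨r, hr, hrb⟩ := Metric.continuous_iff.1 hf x (-f x / 2) (by linarith [not_le.1 hx])
    have h1 : ∫ y in Metric.ball x r, f y ≤ ∫ y in Metric.ball x r, f x / 2 := by
      refine setIntegral_mono_on ?_ (integrableOn_const measure_ball_lt_top.ne)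
        measurableSet_ball fun y hy => ?_
      · exact Continuous.integrableOn_ball hf x r
      · have := (abs_lt.1 (hrb y hy)).2
        linarith
    rw [← hball x r hr, setIntegral_const, Measure.real, Measure.real, Real.volume_ball,
      ENNReal.toReal_ofReal (by positivity), smul_eq_mul] at h1
    have h2 : (0 : ℝ) ≤ (μ (Metric.ball x r)).toReal := ENNReal.toReal_nonneg
    nlinarith [not_le.1 hx]
  refine ⟨f, hf, hf0, fun x => ((le_abs_self _).trans (Complex.abs_re_le_norm _)).trans (hFle x), ?_⟩
  refine Real.measure_ext_Ioo_rat fun a b => ?_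
  by_cases hab : (a : ℝ) < b
  · have hIoo : Ioo (a : ℝ) b = Metric.ball ((a + b) / 2 : ℝ) ((b - a) / 2) := by
      rw [Real.Ioo_eq_ball]
    rw [hIoo, withDensity_apply _ measurableSet_ball,
      ← ofReal_integral_eq_lintegral_ofReal ?_ (ae_of_all _ hf0),
      ← hball _ _ (by linarith), ofReal_measureReal]
    exact (hf.integrableOn_Icc (a := (a : ℝ)) (b := b)).mono_set (by
      rw [← hIoo]; exact Ioo_subset_Icc_self)
  · simp [Ioo_eq_empty hab]

end StochasticHeat


namespace StochasticHeat

/-! ### The energy of occupation measures -/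

/-- Cauchy-Schwarz with the weights `(1 + v²)^(±1/2)`; the constant comes from `∫ (1 + v²)⁻¹ = π`.
-/
lemma lintegral_enorm_le_of_weighted {m : ℝ → ℂ} (hm : Measurable m) :
    ∫⁻ v, ‖m v‖ₑ ≤ ENNReal.ofReal Real.pi ^ (1 / 2 : ℝ) *
      (∫⁻ v, ENNReal.ofReal (1 + v ^ 2) * ‖m v‖ₑ ^ 2) ^ (1 / 2 : ℝ) := by
  have hpos : ∀ v : ℝ, 0 < √(1 + v ^ 2) := fun v => Real.sqrt_pos.2 (by positivity)
  have h := ENNReal.lintegral_mul_le_Lp_mul_Lq (volume : Measure ℝ) Real.HolderConjugate.two_two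
    (f := fun v : ℝ => ENNReal.ofReal (√(1 + v ^ 2))⁻¹)
    (g := fun v : ℝ => ENNReal.ofReal (√(1 + v ^ 2)) * ‖m v‖ₑ)
    (by fun_prop) (by fun_prop)
  have h1 : ∀ v : ℝ, ((fun v : ℝ => ENNReal.ofReal (√(1 + v ^ 2))⁻¹) *
      fun v : ℝ => ENNReal.ofReal (√(1 + v ^ 2)) * ‖m v‖ₑ) v = ‖m v‖ₑ := fun v => by
    rw [Pi.mul_apply, ← mul_assoc, ← ENNReal.ofReal_mul (inv_nonneg.2 (hpos v).le),
      inv_mul_cancel₀ (hpos v).ne', ENNReal.ofReal_one, one_mul]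
  have h2 : ∀ v : ℝ, ENNReal.ofReal (√(1 + v ^ 2))⁻¹ ^ (2 : ℝ) =
      ENNReal.ofReal (1 + v ^ 2)⁻¹ := fun v => by
    rw [ENNReal.rpow_two, ← ENNReal.ofReal_pow (inv_nonneg.2 (hpos v).le), inv_pow,
      Real.sq_sqrt (by positivity)]
  have h3 : ∀ v : ℝ, (ENNReal.ofReal (√(1 + v ^ 2)) * ‖m v‖ₑ) ^ (2 : ℝ) =
      ENNReal.ofReal (1 + v ^ 2) * ‖m v‖ₑ ^ 2 := fun v => by
    rw [ENNReal.rpow_two, mul_pow, ← ENNReal.ofReal_pow (hpos v).le, Real.sq_sqrt (by positivity)]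
  simp_rw [h1, h2, h3] at h
  rwa [← ofReal_integral_eq_lintegral_ofReal integrable_inv_one_add_sq
    (ae_of_all _ fun v => by positivity), integral_univ_inv_one_add_sq] at h

/-- With `β = √d` the exponential is at most `exp(-βv²)`. One half of this exponent absorbs `v²` at
the cost `2/β`, the other integrates to `√(2π/β)`; together they give `d^(-3/4)`. The bound `d ≤ T`
lets `√T` absorb the term 1 of the weight. -/
lemma lintegral_weighted_exp_le {T d : ℝ} (hd : 0 < d) (hdT : d ≤ T) :
    ∫⁻ v : ℝ, ENNReal.ofReal (1 + v ^ 2) *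
      ENNReal.ofReal (Real.exp (-((2 * Real.pi * v) ^ 2 * √(d / Real.pi)) / 2)) ≤
      ENNReal.ofReal ((√T + 2) * √(2 * Real.pi) * d ^ (-(3 / 4) : ℝ)) := by
  set β := √d
  have hβ : 0 < β := Real.sqrt_pos.2 hd
  have hβT : β ≤ √T := Real.sqrt_le_sqrt hdT
  have hb : β ≤ 2 * Real.pi ^ 2 * √(d / Real.pi) := by
    rw [Real.sqrt_div hd.le, mul_div_assoc', le_div_iff₀ (Real.sqrt_pos.2 Real.pi_pos)]
    have h1 : √Real.pi ≤ Real.pi := Real.sqrt_le_iff.2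
      ⟨Real.pi_pos.le, by nlinarith [Real.pi_gt_three]⟩
    have h2 : Real.pi ≤ 2 * Real.pi ^ 2 := by nlinarith [Real.pi_gt_three]
    calc β * √Real.pi ≤ β * (2 * Real.pi ^ 2) := by gcongr; exact h1.trans h2
      _ = _ := mul_comm _ _
  have hpt : ∀ v : ℝ, (1 + v ^ 2) * Real.exp (-((2 * Real.pi * v) ^ 2 * √(d / Real.pi)) / 2) ≤
      (1 + 2 / β) * Real.exp (-(β / 2) * v ^ 2) := by
    intro v
    have h1 : Real.exp (-((2 * Real.pi * v) ^ 2 * √(d / Real.pi)) / 2) ≤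
        Real.exp (-(β / 2) * v ^ 2) * Real.exp (-(β / 2) * v ^ 2) := by
      rw [← Real.exp_add]
      refine Real.exp_le_exp.2 ?_
      nlinarith [mul_le_mul_of_nonneg_right hb (sq_nonneg v)]
    have h2 : v ^ 2 * Real.exp (-(β / 2) * v ^ 2) ≤ 2 / β := by
      have h3 : β / 2 * v ^ 2 + 1 ≤ Real.exp (β / 2 * v ^ 2) := Real.add_one_le_exp _
      have h4 : Real.exp (-(β / 2) * v ^ 2) = (Real.exp (β / 2 * v ^ 2))⁻¹ := by
        rw [neg_mul, Real.exp_neg]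
      rw [h4, ← div_eq_mul_inv, div_le_iff₀ (Real.exp_pos _)]
      calc v ^ 2 = 2 / β * (β / 2 * v ^ 2) := by field_simp
        _ ≤ _ := by gcongr; linarith
    have h5 : Real.exp (-(β / 2) * v ^ 2) ≤ 1 :=
      Real.exp_le_one_iff.2 (by nlinarith [mul_nonneg hβ.le (sq_nonneg v)])
    have h6 := Real.exp_pos (-(β / 2) * v ^ 2)
    calc _ ≤ (1 + v ^ 2) *
          (Real.exp (-(β / 2) * v ^ 2) * Real.exp (-(β / 2) * v ^ 2)) := by gcongr
      _ = (Real.exp (-(β / 2) * v ^ 2) + v ^ 2 * Real.exp (-(β / 2) * v ^ 2)) *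
          Real.exp (-(β / 2) * v ^ 2) := by ring
      _ ≤ _ := by gcongr
  calc _ ≤ ∫⁻ v : ℝ, ENNReal.ofReal ((1 + 2 / β) * Real.exp (-(β / 2) * v ^ 2)) := by
        refine lintegral_mono fun v => ?_
        rw [← ENNReal.ofReal_mul (by positivity)]
        exact ENNReal.ofReal_le_ofReal (hpt v)
    _ = ENNReal.ofReal ((1 + 2 / β) * √(Real.pi / (β / 2))) := by
        rw [← ofReal_integral_eq_lintegral_ofReal
          ((integrable_exp_neg_mul_sq (by positivity)).const_mul _)
          (ae_of_all _ fun v => by positivity), integral_const_mul, integral_gaussian]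
    _ ≤ _ := by
        refine ENNReal.ofReal_le_ofReal ?_
        have h1 : d ^ (-(3 / 4) : ℝ) = β⁻¹ * (√β)⁻¹ := by
          simp only [β]
          rw [Real.sqrt_eq_rpow, Real.sqrt_eq_rpow, ← Real.rpow_mul hd.le, ← Real.rpow_neg hd.le,
            ← Real.rpow_neg hd.le, ← Real.rpow_add hd]
          norm_num
        have h2 : √(Real.pi / (β / 2)) = √(2 * Real.pi) * (√β)⁻¹ := by
          rw [← Real.sqrt_inv, ← Real.sqrt_mul (by positivity)]
          congr 1
          field_simp
        rw [h1, h2]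
        calc (1 + 2 / β) * (√(2 * Real.pi) * (√β)⁻¹)
            = (β + 2) * √(2 * Real.pi) * (β⁻¹ * (√β)⁻¹) := by field_simp
          _ ≤ _ := by gcongr

lemma lintegral_abs_sub_rpow_le {a b : ℝ} {r : ℝ} (hr : r ∈ Ioc a b) :
    ∫⁻ s in Ioc a b, ENNReal.ofReal (|r - s| ^ (-(3 / 4) : ℝ)) ≤
      ENNReal.ofReal (8 * (b - a) ^ (1 / 4 : ℝ)) := by
  have hhalf : ∀ h : ℝ, 0 ≤ h → ∫⁻ s in Ioc 0 h, ENNReal.ofReal (s ^ (-(3 / 4) : ℝ)) =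
      ENNReal.ofReal (4 * h ^ (1 / 4 : ℝ)) := fun h hh => by
    have hi := intervalIntegral.intervalIntegrable_rpow' (r := (-(3 / 4) : ℝ)) (by norm_num)
      (a := 0) (b := h)
    rw [← ofReal_integral_eq_lintegral_ofReal
      ((intervalIntegrable_iff_integrableOn_Ioc_of_le hh).1 hi)
      ((ae_restrict_mem measurableSet_Ioc).mono fun s hs => Real.rpow_nonneg hs.1.le _),
      ← intervalIntegral.integral_of_le hh, integral_rpow (Or.inl (by norm_num))]
    congr 1
    norm_num
    ring
  have hright : ∫⁻ s in Ioc r b, ENNReal.ofReal (|r - s| ^ (-(3 / 4) : ℝ)) =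
      ENNReal.ofReal (4 * (b - r) ^ (1 / 4 : ℝ)) := by
    rw [← hhalf _ (sub_nonneg.2 hr.2), ← lintegral_indicator measurableSet_Ioc,
      ← lintegral_indicator measurableSet_Ioc, ← lintegral_add_right_eq_self _ r]
    refine lintegral_congr fun s => ?_
    by_cases hs : 0 < s
    · simp [indicator, hs, abs_of_pos, le_sub_iff_add_le]
    · simp [indicator, hs]
  have hleft : ∫⁻ s in Ioc a r, ENNReal.ofReal (|r - s| ^ (-(3 / 4) : ℝ)) =
      ENNReal.ofReal (4 * (r - a) ^ (1 / 4 : ℝ)) := by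
    rw [← hhalf _ (sub_nonneg.2 hr.1.le), ← restrict_Ioo_eq_restrict_Ioc,
      ← restrict_Ioo_eq_restrict_Ioc, ← lintegral_indicator measurableSet_Ioo,
      ← lintegral_indicator measurableSet_Ioo, ← lintegral_sub_left_eq_self _ r]
    refine lintegral_congr fun s => ?_
    by_cases hs : 0 < s
    · simp [indicator, hs, abs_of_pos, lt_sub_comm]
    · simp [indicator, hs]
  have h1 : (r - a) ^ (1 / 4 : ℝ) ≤ (b - a) ^ (1 / 4 : ℝ) :=
    Real.rpow_le_rpow (sub_nonneg.2 hr.1.le) (by linarith [hr.2]) (by norm_num)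
  have h2 : (b - r) ^ (1 / 4 : ℝ) ≤ (b - a) ^ (1 / 4 : ℝ) :=
    Real.rpow_le_rpow (sub_nonneg.2 hr.2) (by linarith [hr.1]) (by norm_num)
  have h3 : 0 ≤ (r - a) ^ (1 / 4 : ℝ) := Real.rpow_nonneg (sub_nonneg.2 hr.1.le) _
  have h4 : 0 ≤ (b - r) ^ (1 / 4 : ℝ) := Real.rpow_nonneg (sub_nonneg.2 hr.2) _
  rw [← Ioc_union_Ioc_eq_Ioc hr.1.le hr.2]
  refine (lintegral_union_le _ _ _).trans ?_
  rw [hleft, hright, ← ENNReal.ofReal_add (by positivity) (by positivity)]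
  exact ENNReal.ofReal_le_ofReal (by linarith)

/-- The occupation measure of the path `Y` on the time interval `(a, b]`. -/
noncomputable def occupationMeasure (Y : ℝ → ℝ) (a b : ℝ) : Measure ℝ :=
  (volume.restrict (Ioc a b)).map Y

instance (Y : ℝ → ℝ) (a b : ℝ) : IsFiniteMeasure (occupationMeasure Y a b) := by
  unfold occupationMeasure; infer_instance

lemma charFun_occupationMeasure {Y : ℝ → ℝ} (hY : Measurable Y) (a b θ : ℝ) :
    charFun (occupationMeasure Y a b) θ =
      ∫ r in Ioc a b, Complex.exp ((θ * Y r : ℝ) * Complex.I) := by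
  rw [charFun_apply_real, occupationMeasure, integral_map hY.aemeasurable (by fun_prop)]
  push_cast
  rfl

/-! ### Expected Sobolev energy of the occupation measure -/

namespace IsNondeterministic

variable {Ω : Type*} [MeasurableSpace Ω] {P : Measure Ω} {T : ℝ} {S : Set ℝ} {X : ℝ → Ω → ℝ}

lemma measurable_path (hX : IsNondeterministic P T S X) (ω : Ω) : Measurable fun t => X t ω :=
  hX.measurable.comp (measurable_id.prodMk measurable_const)

lemma measurable_charFun_occupationMeasure (hX : IsNondeterministic P T S X) (a b : ℝ) :
    Measurable fun q : Ω × ℝ => charFun (occupationMeasure (fun t => X t q.1) a b) q.2 := by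
  simp_rw [fun q : Ω × ℝ => charFun_occupationMeasure (hX.measurable_path q.1) a b q.2]
  have h1 : Measurable fun z : (Ω × ℝ) × ℝ => X z.2 z.1.1 :=
    hX.measurable.comp (g := fun q : ℝ × Ω => X q.1 q.2) (f := fun z : (Ω × ℝ) × ℝ => (z.2, z.1.1))
      (by fun_prop)
  have h2 : Measurable fun z : (Ω × ℝ) × ℝ =>
      Complex.exp ((z.1.2 * X z.2 z.1.1 : ℝ) * Complex.I) := by
    have h3 : Measurable fun z : (Ω × ℝ) × ℝ => z.1.2 * X z.2 z.1.1 :=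
      (measurable_snd.comp measurable_fst).mul h1
    fun_prop
  exact h2.stronglyMeasurable.integral_prod_right'.measurable

/-- The squared modulus is a double time integral of `exp(iθ(X_r - X_s))`; Fubini moves the
expectation inside, onto the characteristic functions of increments. -/
lemma lintegral_enorm_charFun_sq_le [IsProbabilityMeasure P] (hX : IsNondeterministic P T S X)
    {a b : ℝ} (ha : 0 ≤ a) (hbT : b ≤ T) (θ : ℝ) :
    ∫⁻ ω, ‖charFun (occupationMeasure (fun t => X t ω) a b) θ‖ₑ ^ 2 ∂P ≤
      ∫⁻ r in Ioc a b, ∫⁻ s in Ioc a b,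
        ENNReal.ofReal (Real.exp (-(θ ^ 2 * √(|r - s| / Real.pi)) / 2)) := by
  set ν : Measure ℝ := volume.restrict (Ioc a b)
  set e : ℝ × Ω → ℂ := fun q => Complex.exp ((θ * X q.1 q.2 : ℝ) * Complex.I)
  have hXm := hX.measurable
  have hE : Measurable fun z : Ω × (ℝ × ℝ) =>
      Complex.exp ((θ * (X z.2.1 z.1 - X z.2.2 z.1) : ℝ) * Complex.I) := by
    have h1 : Measurable fun z : Ω × (ℝ × ℝ) => X z.2.1 z.1 :=
      hX.measurable.comp (g := fun q : ℝ × Ω => X q.1 q.2)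
        (f := fun z : Ω × (ℝ × ℝ) => (z.2.1, z.1)) (by fun_prop)
    have h2 : Measurable fun z : Ω × (ℝ × ℝ) => X z.2.2 z.1 :=
      hX.measurable.comp (g := fun q : ℝ × Ω => X q.1 q.2)
        (f := fun z : Ω × (ℝ × ℝ) => (z.2.2, z.1)) (by fun_prop)
    fun_prop
  have hEint : Integrable (fun z : Ω × (ℝ × ℝ) =>
      Complex.exp ((θ * (X z.2.1 z.1 - X z.2.2 z.1) : ℝ) * Complex.I)) (P.prod (ν.prod ν)) :=
    Integrable.of_bound (C := 1) hE.aestronglyMeasurable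
      (ae_of_all _ fun z => (Complex.norm_exp_ofReal_mul_I _).le)
  have hz : ∀ ω, ((‖charFun (occupationMeasure (fun t => X t ω) a b) θ‖ ^ 2 : ℝ) : ℂ) =
      ∫ q, Complex.exp ((θ * (X q.1 ω - X q.2 ω) : ℝ) * Complex.I) ∂ν.prod ν := fun ω => by
    rw [← Complex.normSq_eq_norm_sq, Complex.normSq_eq_conj_mul_self, mul_comm,
      charFun_occupationMeasure (hX.measurable_path ω), ← integral_conj, ← integral_prod_mul]
    refine integral_congr_ae (ae_of_all _ fun q => ?_)
    simp only
    rw [← Complex.exp_conj, ← Complex.exp_add]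
    congr 1
    simp only [map_mul, Complex.conj_ofReal, Complex.conj_I]
    push_cast
    ring
  have hzint : Integrable (fun ω => ‖charFun (occupationMeasure (fun t => X t ω) a b) θ‖ ^ 2) P := by
    have h1 := hEint.integral_prod_left
    simp_rw [← hz] at h1
    refine h1.re.congr (ae_of_all _ fun ω => ?_)
    simp only [RCLike.re_eq_complex_re, Complex.ofReal_re]
  have h1 : ∫⁻ ω, ‖charFun (occupationMeasure (fun t => X t ω) a b) θ‖ₑ ^ 2 ∂P =
      ENNReal.ofReal (∫ ω, ‖charFun (occupationMeasure (fun t => X t ω) a b) θ‖ ^ 2 ∂P) := by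
    rw [ofReal_integral_eq_lintegral_ofReal hzint (ae_of_all _ fun _ => by positivity)]
    refine lintegral_congr fun ω => ?_
    rw [ENNReal.ofReal_pow (norm_nonneg _), ofReal_norm]
  have h2 : ∫ ω, ‖charFun (occupationMeasure (fun t => X t ω) a b) θ‖ ^ 2 ∂P ≤
      ‖∫ q, ∫ ω, Complex.exp ((θ * (X q.1 ω - X q.2 ω) : ℝ) * Complex.I) ∂P ∂ν.prod ν‖ := by
    rw [← integral_integral_swap hEint]
    simp_rw [← hz]
    rw [integral_complex_ofReal, Complex.norm_real]
    exact le_abs_self _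
  have hm2 : Measurable fun q : ℝ × ℝ =>
      ENNReal.ofReal (Real.exp (-(θ ^ 2 * √(|q.1 - q.2| / Real.pi)) / 2)) := by fun_prop
  rw [h1, ← lintegral_prod _ hm2.aemeasurable]
  refine (ENNReal.ofReal_le_ofReal h2).trans ?_
  rw [ofReal_norm]
  refine (enorm_integral_le_lintegral_enorm _).trans (lintegral_mono_ae ?_)
  have hS : ∀ᵐ r ∂ν, r ∈ S := hX.ae_mem_Ioc ha hbT
  have hS1 : ∀ᵐ q ∂ν.prod ν, q.1 ∈ S := Measure.quasiMeasurePreserving_fst.ae hS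
  have hS2 : ∀ᵐ q ∂ν.prod ν, q.2 ∈ S := Measure.quasiMeasurePreserving_snd.ae hS
  filter_upwards [hS1, hS2] with q h3 h4
  rw [← ofReal_norm]
  refine ENNReal.ofReal_le_ofReal ?_
  rcases le_total q.2 q.1 with h | h
  · rw [abs_of_nonneg (sub_nonneg.2 h)]
    exact hX.norm_integral_le θ _ h4 _ h3 h
  -- For times in the opposite order, the increment changes sign and the bound is applied at `-θ`.
  · rw [abs_sub_comm, abs_of_nonneg (sub_nonneg.2 h)]
    have := hX.norm_integral_le (-θ) _ h3 _ h4 h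
    rw [neg_sq] at this
    simpa only [show ∀ ω, -θ * (X q.2 ω - X q.1 ω) = θ * (X q.1 ω - X q.2 ω) from
      fun ω => by ring] using this

/-- The Sobolev energy of the occupation measure of a path on `(a, b]`. -/
noncomputable def occupationEnergy (X : ℝ → Ω → ℝ) (a b : ℝ) (ω : Ω) : ℝ≥0∞ :=
  ∫⁻ v, ENNReal.ofReal (1 + v ^ 2) *
    ‖charFun (occupationMeasure (fun t => X t ω) a b) (2 * Real.pi * v)‖ₑ ^ 2

lemma measurable_occupationEnergy_integrand (hX : IsNondeterministic P T S X) (a b : ℝ) :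
    Measurable fun q : Ω × ℝ => ENNReal.ofReal (1 + q.2 ^ 2) *
      ‖charFun (occupationMeasure (fun t => X t q.1) a b) (2 * Real.pi * q.2)‖ₑ ^ 2 := by
  have := (hX.measurable_charFun_occupationMeasure a b).comp
    (g := fun q : Ω × ℝ => charFun (occupationMeasure (fun t => X t q.1) a b) q.2)
    (f := fun q : Ω × ℝ => (q.1, 2 * Real.pi * q.2)) (by fun_prop)
  exact Measurable.mul (by fun_prop) (this.enorm.pow_const 2)

lemma measurable_occupationEnergy (hX : IsNondeterministic P T S X) (a b : ℝ) :
    Measurable (occupationEnergy X a b) :=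
  (hX.measurable_occupationEnergy_integrand a b).lintegral_prod_right'

/-- Integrating the energy kernel `|r - s|^(-3/4)` in `s` gives the exponent `1/4`, and integrating
in `r` adds 1. That `5/4` exceeds 1 is what later permits summation over all dyadic intervals of one
length. -/
theorem exists_lintegral_occupationEnergy_le [IsProbabilityMeasure P]
    (hX : IsNondeterministic P T S X) :
    ∃ C : ℝ, 0 ≤ C ∧ ∀ a b : ℝ, 0 ≤ a → a ≤ b → b ≤ T →
      ∫⁻ ω, occupationEnergy X a b ω ∂P ≤ ENNReal.ofReal (C * (b - a) ^ (5 / 4 : ℝ)) := by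
  set K : ℝ := (√T + 2) * √(2 * Real.pi)
  have hK : 0 ≤ K := by positivity
  refine ⟨8 * K, by positivity, fun a b ha hab hbT => ?_⟩
  have hba := sub_nonneg.2 hab
  have hmq : ∀ r : ℝ, Measurable fun q : ℝ × ℝ => ENNReal.ofReal (1 + q.2 ^ 2) *
      ENNReal.ofReal (Real.exp (-((2 * Real.pi * q.2) ^ 2 * √(|r - q.1| / Real.pi)) / 2)) :=
    fun r => by fun_prop
  have hmr : Measurable fun q : ℝ × ℝ => ∫⁻ s in Ioc a b, ENNReal.ofReal (1 + q.2 ^ 2) *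
      ENNReal.ofReal (Real.exp (-((2 * Real.pi * q.2) ^ 2 * √(|q.1 - s| / Real.pi)) / 2)) := by
    have : Measurable fun z : (ℝ × ℝ) × ℝ => ENNReal.ofReal (1 + z.1.2 ^ 2) * ENNReal.ofReal
        (Real.exp (-((2 * Real.pi * z.1.2) ^ 2 * √(|z.1.1 - z.2| / Real.pi)) / 2)) := by fun_prop
    exact this.lintegral_prod_right'
  unfold occupationEnergy
  rw [lintegral_lintegral_swap (hX.measurable_occupationEnergy_integrand a b).aemeasurable]
  calc _ ≤ ∫⁻ v, ∫⁻ r in Ioc a b, ∫⁻ s in Ioc a b, ENNReal.ofReal (1 + v ^ 2) *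
          ENNReal.ofReal (Real.exp (-((2 * Real.pi * v) ^ 2 * √(|r - s| / Real.pi)) / 2)) := by
        refine lintegral_mono fun v => ?_
        simp only
        rw [lintegral_const_mul' _ _ ENNReal.ofReal_ne_top]
        simp_rw [lintegral_const_mul' _ _ (ENNReal.ofReal_ne_top (r := 1 + v ^ 2))]
        exact mul_le_mul_right (hX.lintegral_enorm_charFun_sq_le ha hbT _) _
    _ = ∫⁻ r in Ioc a b, ∫⁻ v, ∫⁻ s in Ioc a b, ENNReal.ofReal (1 + v ^ 2) *
          ENNReal.ofReal (Real.exp (-((2 * Real.pi * v) ^ 2 * √(|r - s| / Real.pi)) / 2)) := by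
        exact (lintegral_lintegral_swap hmr.aemeasurable).symm
    _ = ∫⁻ r in Ioc a b, ∫⁻ s in Ioc a b, ∫⁻ v, ENNReal.ofReal (1 + v ^ 2) *
          ENNReal.ofReal (Real.exp (-((2 * Real.pi * v) ^ 2 * √(|r - s| / Real.pi)) / 2)) := by
        refine lintegral_congr fun r => ?_
        exact (lintegral_lintegral_swap (hmq r).aemeasurable).symm
    _ ≤ ∫⁻ r in Ioc a b, ∫⁻ s in Ioc a b,
          ENNReal.ofReal K * ENNReal.ofReal (|r - s| ^ (-(3 / 4) : ℝ)) := by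
        refine lintegral_mono_ae ?_
        filter_upwards [ae_restrict_mem measurableSet_Ioc] with r hr
        refine lintegral_mono_ae ?_
        have hne : ∀ᵐ s ∂volume.restrict (Ioc a b), s ≠ r :=
          ae_restrict_of_ae (Measure.ae_ne volume r)
        filter_upwards [ae_restrict_mem measurableSet_Ioc, hne] with s hs hsr
        rw [← ENNReal.ofReal_mul hK]
        refine lintegral_weighted_exp_le (abs_pos.2 (sub_ne_zero.2 hsr.symm)) ?_
        exact abs_le.2 ⟨by linarith [hr.1, hs.2], by linarith [hr.2, hs.1]⟩
    _ ≤ ∫⁻ _ in Ioc a b, ENNReal.ofReal K * ENNReal.ofReal (8 * (b - a) ^ (1 / 4 : ℝ)) := by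
        refine setLIntegral_mono measurable_const fun r hr => ?_
        rw [lintegral_const_mul' _ _ ENNReal.ofReal_ne_top]
        exact mul_le_mul_right (lintegral_abs_sub_rpow_le hr) _
    _ = _ := by
        rw [setLIntegral_const, Real.volume_Ioc, ← ENNReal.ofReal_mul hK,
          ← ENNReal.ofReal_mul (by positivity)]
        congr 1
        rcases hba.eq_or_lt with h | h
        · rw [← h]; norm_num
        · rw [show (5 / 4 : ℝ) = 1 / 4 + 1 by norm_num, Real.rpow_add h, Real.rpow_one]
          ring

end IsNondeterministic

end StochasticHeat


namespace StochasticHeat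

/-! ### The upper density of a measure on the line -/

/-- The upper density of `μ` at `ξ` along the intervals of radius `1 / (m + 1)`. -/
noncomputable def upperDensity (μ : Measure ℝ) (ξ : ℝ) : ℝ≥0∞ :=
  limsup (fun m : ℕ => μ (Metric.ball ξ (1 / ((m : ℝ) + 1))) /
    ENNReal.ofReal (2 * (1 / ((m : ℝ) + 1)))) atTop

/-- The upper density makes sense before any density is known to exist. Monotonicity and
subadditivity therefore control it at nondyadic times by its values on dyadic intervals. -/
lemma upperDensity_mono {μ ν : Measure ℝ} (h : μ ≤ ν) (ξ : ℝ) :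
    upperDensity μ ξ ≤ upperDensity ν ξ :=
  limsup_le_limsup (Eventually.of_forall fun _ => ENNReal.div_le_div_right (h _) _)

lemma limsup_add_le_atTop (u v : ℕ → ℝ≥0∞) :
    limsup (fun n => u n + v n) atTop ≤ limsup u atTop + limsup v atTop := by
  have hanti : ∀ w : ℕ → ℝ≥0∞, Antitone fun n => ⨆ i, w (i + n) := fun w m n hmn =>
    iSup_le fun k => le_iSup_of_le (k + (n - m)) (by rw [add_assoc, Nat.sub_add_cancel hmn])
  simp_rw [limsup_eq_iInf_iSup_of_nat']
  rw [ENNReal.iInf_add_iInf fun i j => ⟨max i j, add_le_add (hanti u (le_max_left i j))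
    (hanti v (le_max_right i j))⟩]
  exact iInf_mono fun n => iSup_le fun k => add_le_add (le_iSup (fun i => u (i + n)) k)
    (le_iSup (fun i => v (i + n)) k)

lemma upperDensity_add_le (μ ν : Measure ℝ) (ξ : ℝ) :
    upperDensity (μ + ν) ξ ≤ upperDensity μ ξ + upperDensity ν ξ := by
  unfold upperDensity
  simp_rw [Measure.add_apply, ENNReal.add_div]
  exact limsup_add_le_atTop _ _

lemma upperDensity_withDensity {f : ℝ → ℝ} (hf : Continuous f) (hf0 : ∀ x, 0 ≤ f x) (ξ : ℝ) :
    upperDensity (volume.withDensity fun x => ENNReal.ofReal (f x)) ξ = ENNReal.ofReal (f ξ) := by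
  refine Tendsto.limsup_eq ?_
  refine ((ENNReal.tendsto_ofReal (tendsto_average_ball hf ξ)).comp
    tendsto_one_div_add_atTop_nhdsGT_zero).congr fun m => ?_
  have hm : (0 : ℝ) < 2 * (1 / ((m : ℝ) + 1)) := by positivity
  rw [Function.comp_apply, ENNReal.ofReal_div_of_pos hm,
    withDensity_apply _ measurableSet_ball, ofReal_integral_eq_lintegral_ofReal
      (Continuous.integrableOn_ball hf _ _) (ae_of_all _ hf0)]

/-! ### Local times from densities over dyadic time intervals -/

lemma occupationMeasure_mono {Y : ℝ → ℝ} (hY : Measurable Y) {a b a' b' : ℝ} (ha : a' ≤ a)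
    (hb : b ≤ b') : occupationMeasure Y a b ≤ occupationMeasure Y a' b' :=
  Measure.map_mono (Measure.restrict_mono (Ioc_subset_Ioc ha hb) le_rfl) hY

lemma occupationMeasure_add {Y : ℝ → ℝ} (hY : Measurable Y) {a b c : ℝ} (hab : a ≤ b)
    (hbc : b ≤ c) :
    occupationMeasure Y a c = occupationMeasure Y a b + occupationMeasure Y b c := by
  unfold occupationMeasure
  rw [← Ioc_union_Ioc_eq_Ioc hab hbc, Measure.restrict_union (Ioc_disjoint_Ioc_of_le le_rfl)
    measurableSet_Ioc, Measure.map_add _ _ hY]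

lemma occupationMeasure_apply {Y : ℝ → ℝ} (hY : Measurable Y) (a b : ℝ) {A : Set ℝ}
    (hA : MeasurableSet A) : occupationMeasure Y a b A = volume (Y ⁻¹' A ∩ Ioc a b) := by
  rw [occupationMeasure, Measure.map_apply hY hA, Measure.restrict_apply (hY hA)]

lemma occupationMeasure_le_volume {Y : ℝ → ℝ} (hY : Measurable Y) (a b : ℝ) {A : Set ℝ}
    (hA : MeasurableSet A) : occupationMeasure Y a b A ≤ ENNReal.ofReal (b - a) := by
  rw [occupationMeasure_apply hY a b hA, ← Real.volume_Ioc]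
  exact measure_mono inter_subset_right

/-- `μ` has a continuous nonnegative density with respect to Lebesgue measure. -/
def HasContinuousDensity (μ : Measure ℝ) : Prop :=
  ∃ f : ℝ → ℝ, Continuous f ∧ (∀ x, 0 ≤ f x) ∧
    μ = volume.withDensity fun x => ENNReal.ofReal (f x)

namespace HasContinuousDensity

lemma zero : HasContinuousDensity 0 :=
  ⟨0, continuous_const, fun _ => le_rfl, by simp⟩

lemma add {μ ν : Measure ℝ} (hμ : HasContinuousDensity μ) (hν : HasContinuousDensity ν) :
    HasContinuousDensity (μ + ν) := by
  obtain ⟨f, hf, hf0, rfl⟩ := hμ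
  obtain ⟨g, hg, hg0, rfl⟩ := hν
  refine ⟨f + g, hf.add hg, fun x => add_nonneg (hf0 x) (hg0 x), ?_⟩
  rw [← withDensity_add_left hf.measurable.ennreal_ofReal]
  congr 1
  funext x
  simp [ENNReal.ofReal_add (hf0 x) (hg0 x)]

lemma upperDensity_ne_top {μ : Measure ℝ} (h : HasContinuousDensity μ) (ξ : ℝ) :
    upperDensity μ ξ ≠ ∞ := by
  obtain ⟨f, hf, hf0, rfl⟩ := h
  simp [upperDensity_withDensity hf hf0]

lemma continuous {μ : Measure ℝ} (h : HasContinuousDensity μ) :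
    Continuous fun ξ => (upperDensity μ ξ).toReal := by
  obtain ⟨f, hf, hf0, rfl⟩ := h
  simpa only [upperDensity_withDensity hf hf0, ENNReal.toReal_ofReal (hf0 _)] using hf

lemma eq_withDensity {μ : Measure ℝ} (h : HasContinuousDensity μ) :
    μ = volume.withDensity (upperDensity μ) := by
  obtain ⟨f, hf, hf0, rfl⟩ := h
  congr 1
  funext ξ
  exact (upperDensity_withDensity hf hf0 ξ).symm

end HasContinuousDensity

/-- The occupation measures of `Y` over the dyadic subintervals of `(0, T]` of length `T / 2 ^ n`
have continuous densities that are bounded by `δ n`. -/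
def HasDyadicDensities (T : ℝ) (Y : ℝ → ℝ) (δ : ℕ → ℝ) : Prop :=
  ∀ n k : ℕ, k < 2 ^ n → ∃ f : ℝ → ℝ, Continuous f ∧ (∀ x, 0 ≤ f x) ∧ (∀ x, f x ≤ δ n) ∧
    occupationMeasure Y (T * k / 2 ^ n) (T * (k + 1) / 2 ^ n) =
      volume.withDensity fun x => ENNReal.ofReal (f x)

namespace HasDyadicDensities

variable {T : ℝ} {Y : ℝ → ℝ} {δ : ℕ → ℝ}

lemma nonneg (h : HasDyadicDensities T Y δ) (n : ℕ) : 0 ≤ δ n := by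
  obtain ⟨f, -, hf0, hfδ, -⟩ := h n 0 (by positivity)
  exact (hf0 0).trans (hfδ 0)

lemma upperDensity_le (h : HasDyadicDensities T Y δ) {n k : ℕ} (hk : k < 2 ^ n) (ξ : ℝ) :
    upperDensity (occupationMeasure Y (T * k / 2 ^ n) (T * (k + 1) / 2 ^ n)) ξ ≤
      ENNReal.ofReal (δ n) := by
  obtain ⟨f, hf, hf0, hfδ, hfe⟩ := h n k hk
  rw [hfe, upperDensity_withDensity hf hf0]
  exact ENNReal.ofReal_le_ofReal (hfδ ξ)

lemma hasContinuousDensity (h : HasDyadicDensities T Y δ) (hT : 0 < T) (hY : Measurable Y) (n : ℕ) :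
    ∀ k : ℕ, k ≤ 2 ^ n → HasContinuousDensity (occupationMeasure Y 0 (T * k / 2 ^ n))
  | 0, _ => by simpa [occupationMeasure] using HasContinuousDensity.zero
  | k + 1, hk => by
    obtain ⟨f, hf, hf0, -, hfe⟩ := h n k hk
    rw [Nat.cast_succ, occupationMeasure_add hY (b := T * k / 2 ^ n) (by positivity)
      (by gcongr; simp)]
    exact (h.hasContinuousDensity hT hY n k (by omega)).add ⟨f, hf, hf0, hfe⟩

lemma hasContinuousDensity_end (h : HasDyadicDensities T Y δ) (hT : 0 < T) (hY : Measurable Y) :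
    HasContinuousDensity (occupationMeasure Y 0 T) := by
  simpa using h.hasContinuousDensity hT hY 0 1 le_rfl

lemma upperDensity_ne_top (h : HasDyadicDensities T Y δ) (hT : 0 < T) (hY : Measurable Y) {t : ℝ}
    (ht : t ≤ T) (ξ : ℝ) : upperDensity (occupationMeasure Y 0 t) ξ ≠ ∞ :=
  ((upperDensity_mono (occupationMeasure_mono hY le_rfl ht) ξ).trans_lt
    ((h.hasContinuousDensity_end hT hY).upperDensity_ne_top ξ).lt_top).ne

/-- An interval no longer than `T / 2 ^ n` is covered by two consecutive dyadic intervals of that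
length, whence the factor 2. -/
lemma upperDensity_short_le (h : HasDyadicDensities T Y δ) (hT : 0 < T) (hY : Measurable Y) {n : ℕ}
    {s t : ℝ} (hs : 0 ≤ s) (hst : s ≤ t) (ht : t ≤ T) (hd : t - s ≤ T / 2 ^ n) (ξ : ℝ) :
    upperDensity (occupationMeasure Y s t) ξ ≤ ENNReal.ofReal (2 * δ n) := by
  have h2 : (0 : ℝ) < 2 ^ n := by positivity
  have hδ := h.nonneg n
  rcases hst.eq_or_lt with rfl | hst
  · have : occupationMeasure Y s s = volume.withDensity fun x => ENNReal.ofReal 0 := by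
      simp [occupationMeasure]
    rw [this, upperDensity_withDensity (f := fun _ => 0) continuous_const fun _ => le_rfl]
    simp
  set k := ⌊s * 2 ^ n / T⌋₊
  have hk1 : T * k / 2 ^ n ≤ s := by
    have := Nat.floor_le (show 0 ≤ s * 2 ^ n / T by positivity)
    rw [le_div_iff₀ hT] at this
    rw [div_le_iff₀ h2]; linarith
  have hk2 : s < T * (k + 1) / 2 ^ n := by
    have := Nat.lt_floor_add_one (s * 2 ^ n / T)
    rw [div_lt_iff₀ hT] at this
    rw [lt_div_iff₀ h2]; linarith
  have hk3 : k < 2 ^ n := by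
    rw [Nat.floor_lt (by positivity), div_lt_iff₀ hT]
    push_cast
    nlinarith
  have hI := h.upperDensity_le hk3 ξ
  have hle : ENNReal.ofReal (δ n) ≤ ENNReal.ofReal (2 * δ n) :=
    ENNReal.ofReal_le_ofReal (by linarith)
  rcases (Nat.succ_le_of_lt hk3).lt_or_eq with hk4 | hk4
  · have hJ := h.upperDensity_le hk4 ξ
    rw [Nat.cast_succ] at hJ
    have ht2 : t ≤ T * (k + 1 + 1) / 2 ^ n := by
      rw [show T * ((k : ℝ) + 1 + 1) / 2 ^ n = T * (k + 1) / 2 ^ n + T / 2 ^ n by ring]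
      linarith
    refine (upperDensity_mono (occupationMeasure_mono hY hk1 ht2) ξ).trans ?_
    rw [occupationMeasure_add hY (b := T * (k + 1) / 2 ^ n) (by gcongr; simp) (by gcongr; simp),
      two_mul, ENNReal.ofReal_add hδ hδ]
    exact (upperDensity_add_le _ _ ξ).trans (add_le_add hI hJ)
  -- The last dyadic interval has no successor, but then `t ≤ T` keeps `(s, t]` inside it.
  · have ht2 : t ≤ T * (k + 1) / 2 ^ n := by
      have : ((k : ℝ) + 1) = 2 ^ n := by exact_mod_cast hk4
      rw [this, mul_div_cancel_right₀ _ h2.ne']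
      exact ht
    exact (upperDensity_mono (occupationMeasure_mono hY hk1 ht2) ξ).trans (hI.trans hle)

lemma toReal_mono (h : HasDyadicDensities T Y δ) (hT : 0 < T) (hY : Measurable Y) {s t : ℝ}
    (hst : s ≤ t) (ht : t ≤ T) (ξ : ℝ) :
    (upperDensity (occupationMeasure Y 0 s) ξ).toReal ≤
      (upperDensity (occupationMeasure Y 0 t) ξ).toReal :=
  ENNReal.toReal_mono (h.upperDensity_ne_top hT hY ht ξ)
    (upperDensity_mono (occupationMeasure_mono hY le_rfl hst) ξ)

lemma toReal_le_add (h : HasDyadicDensities T Y δ) (hT : 0 < T) (hY : Measurable Y) {n : ℕ}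
    {s t : ℝ} (hs : 0 ≤ s) (hst : s ≤ t) (ht : t ≤ T) (hd : t - s ≤ T / 2 ^ n) (ξ : ℝ) :
    (upperDensity (occupationMeasure Y 0 t) ξ).toReal ≤
      (upperDensity (occupationMeasure Y 0 s) ξ).toReal + 2 * δ n := by
  have hδ : 0 ≤ 2 * δ n := by have := h.nonneg n; positivity
  have hs' := h.upperDensity_ne_top hT hY (hst.trans ht) ξ
  rw [← ENNReal.toReal_ofReal hδ, ← ENNReal.toReal_add hs' ENNReal.ofReal_ne_top,
    occupationMeasure_add hY hs hst]
  refine ENNReal.toReal_mono (ENNReal.add_ne_top.2 ⟨hs', ENNReal.ofReal_ne_top⟩) ?_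
  exact (upperDensity_add_le _ _ ξ).trans
    (add_le_add le_rfl (h.upperDensity_short_le hT hY hs hst ht hd ξ))

lemma dist_toReal_le (h : HasDyadicDensities T Y δ) (hT : 0 < T) (hY : Measurable Y) {n : ℕ}
    {s t : ℝ} (hs : s ∈ Icc 0 T) (ht : t ∈ Icc 0 T) (hd : |t - s| ≤ T / 2 ^ n) (ξ : ℝ) :
    dist (upperDensity (occupationMeasure Y 0 t) ξ).toReal
      (upperDensity (occupationMeasure Y 0 s) ξ).toReal ≤ 2 * δ n := by
  rw [Real.dist_eq]
  have hδ := h.nonneg n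
  rcases le_total s t with hst | hst
  · have h1 := h.toReal_mono hT hY hst ht.2 ξ
    have h2 := h.toReal_le_add hT hY hs.1 hst ht.2 ((le_abs_self _).trans hd) ξ
    exact abs_le.2 ⟨by linarith, by linarith⟩
  · have h1 := h.toReal_mono hT hY hst hs.2 ξ
    have h2 := h.toReal_le_add hT hY ht.1 hst hs.2
      ((le_abs_self _).trans (by rwa [abs_sub_comm])) ξ
    exact abs_le.2 ⟨by linarith, by linarith⟩

lemma exists_dyadic_le (h : HasDyadicDensities T Y δ) (hT : 0 < T) (hY : Measurable Y) {t : ℝ}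
    (ht : t ∈ Icc 0 T) (n : ℕ) :
    ∃ s ∈ Icc 0 t, t - s ≤ T / 2 ^ n ∧ HasContinuousDensity (occupationMeasure Y 0 s) := by
  have h2 : (0 : ℝ) < 2 ^ n := by positivity
  have ht0 := ht.1
  set k := ⌊t * 2 ^ n / T⌋₊
  have hk1 : T * k / 2 ^ n ≤ t := by
    have := Nat.floor_le (show 0 ≤ t * 2 ^ n / T by positivity)
    rw [le_div_iff₀ hT] at this
    rw [div_le_iff₀ h2]; linarith
  have hk2 : t < T * (k + 1) / 2 ^ n := by
    have := Nat.lt_floor_add_one (t * 2 ^ n / T)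
    rw [div_lt_iff₀ hT] at this
    rw [lt_div_iff₀ h2]; linarith
  have hk3 : k ≤ 2 ^ n := by
    have h3 : t * 2 ^ n / T ≤ ((2 ^ n : ℕ) : ℝ) := by
      rw [div_le_iff₀ hT]
      push_cast
      nlinarith [ht.2]
    exact Nat.floor_le_of_le h3
  refine ⟨T * k / 2 ^ n, ⟨by positivity, hk1⟩, ?_, h.hasContinuousDensity hT hY n k hk3⟩
  rw [mul_add, mul_one, add_div] at hk2
  linarith

/-- At dyadic times the upper density is a finite sum of continuous densities; at time `t` it is a
uniform limit of these. -/
lemma continuous_toReal (h : HasDyadicDensities T Y δ) (hδ : Tendsto δ atTop (𝓝 0)) (hT : 0 < T)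
    (hY : Measurable Y) {t : ℝ} (ht : t ∈ Icc 0 T) :
    Continuous fun ξ => (upperDensity (occupationMeasure Y 0 t) ξ).toReal := by
  choose s hs hsd hsc using h.exists_dyadic_le hT hY ht
  refine TendstoUniformly.continuous (F := fun n ξ =>
    (upperDensity (occupationMeasure Y 0 (s n)) ξ).toReal) (p := atTop) ?_
    (Frequently.of_forall fun n => (hsc n).continuous)
  rw [Metric.tendstoUniformly_iff]
  intro ε hε
  have h1 : Tendsto (fun n => 2 * δ n) atTop (𝓝 0) := by simpa using hδ.const_mul 2
  filter_upwards [h1.eventually (gt_mem_nhds hε)] with n hn ξ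
  refine (h.dist_toReal_le hT hY ⟨(hs n).1, (hs n).2.trans ht.2⟩ ht ?_ ξ).trans_lt hn
  rw [abs_of_nonneg (sub_nonneg.2 (hs n).2)]
  exact hsd n

/-- The modulus of continuity in time is uniform in `ξ`, so separate continuity in `ξ` upgrades to
joint continuity. -/
lemma continuousOn_toReal (h : HasDyadicDensities T Y δ) (hδ : Tendsto δ atTop (𝓝 0)) (hT : 0 < T)
    (hY : Measurable Y) :
    ContinuousOn (fun q : ℝ × ℝ => (upperDensity (occupationMeasure Y 0 q.2) q.1).toReal)
      (univ ×ˢ Icc 0 T) := by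
  rintro ⟨ξ, t⟩ ⟨-, ht⟩
  rw [ContinuousWithinAt, Metric.tendsto_nhds]
  intro ε hε
  have h1 : Tendsto (fun n => 2 * δ n) atTop (𝓝 0) := by simpa using hδ.const_mul 2
  obtain ⟨n, hn⟩ := (h1.eventually (gt_mem_nhds (half_pos hε))).exists
  have h2 := (Metric.continuous_iff'.1 (h.continuous_toReal hδ hT hY ht) ξ (ε / 2) (half_pos hε))
  have h3 : ∀ᶠ q : ℝ × ℝ in 𝓝[univ ×ˢ Icc 0 T] (ξ, t),
      dist (upperDensity (occupationMeasure Y 0 t) q.1).toReal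
        (upperDensity (occupationMeasure Y 0 t) ξ).toReal < ε / 2 :=
    nhdsWithin_le_nhds ((continuous_fst.tendsto (ξ, t)).eventually h2)
  have h4 : ∀ᶠ q : ℝ × ℝ in 𝓝[univ ×ˢ Icc 0 T] (ξ, t), |q.2 - t| ≤ T / 2 ^ n := by
    refine nhdsWithin_le_nhds ((continuous_snd.tendsto (ξ, t)).eventually
      ((Metric.closedBall_mem_nhds t (show 0 < T / 2 ^ n by positivity))))
  filter_upwards [h3, h4, self_mem_nhdsWithin] with q hq3 hq4 hq
  have h5 := h.dist_toReal_le hT hY ht hq.2 hq4 q.1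
  calc _ ≤ _ := dist_triangle _ (upperDensity (occupationMeasure Y 0 t) q.1).toReal _
    _ < ε := by linarith

/-- The identity holds at dyadic times below `t` and passes to the limit: the occupation measure
loses at most `T / 2 ^ n`, and the densities are dominated by the integrable one at time `T`. -/
lemma occupationMeasure_apply_eq (h : HasDyadicDensities T Y δ) (hδ : Tendsto δ atTop (𝓝 0))
    (hT : 0 < T) (hY : Measurable Y) {t : ℝ} (ht : t ∈ Icc 0 T) {A : Set ℝ}
    (hA : MeasurableSet A) :
    occupationMeasure Y 0 t A = ∫⁻ ξ in A, upperDensity (occupationMeasure Y 0 t) ξ := by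
  choose s hs hsd hsc using h.exists_dyadic_le hT hY ht
  have hcont : ∀ r ∈ Icc 0 T, Measurable (upperDensity (occupationMeasure Y 0 r)) := fun r hr => by
    have := (h.continuous_toReal hδ hT hY hr).measurable.ennreal_ofReal
    simpa only [ENNReal.ofReal_toReal (h.upperDensity_ne_top hT hY hr.2 _)] using this
  have hsT : ∀ n, s n ∈ Icc 0 T := fun n => ⟨(hs n).1, (hs n).2.trans ht.2⟩
  have h0 : Tendsto (fun n : ℕ => T / 2 ^ n) atTop (𝓝 0) := by
    have := (tendsto_pow_atTop_nhds_zero_of_lt_one (r := (1 / 2 : ℝ)) (by norm_num)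
      (by norm_num)).const_mul T
    simpa [div_eq_mul_inv] using this
  have hleft : Tendsto (fun n => occupationMeasure Y 0 (s n) A) atTop
      (𝓝 (occupationMeasure Y 0 t A)) := by
    have h1 : Tendsto (fun n => occupationMeasure Y 0 t A - ENNReal.ofReal (T / 2 ^ n)) atTop
        (𝓝 (occupationMeasure Y 0 t A)) := by
      simpa using ENNReal.Tendsto.sub (tendsto_const_nhds (x := occupationMeasure Y 0 t A))
        (ENNReal.tendsto_ofReal h0) (Or.inl (measure_ne_top _ _))
    refine tendsto_of_tendsto_of_tendsto_of_le_of_le h1 tendsto_const_nhds (fun n => ?_)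
      fun n => occupationMeasure_mono hY le_rfl (hs n).2 A
    rw [tsub_le_iff_right, occupationMeasure_add hY (hs n).1 (hs n).2, Measure.add_apply]
    gcongr
    exact (occupationMeasure_le_volume hY _ _ hA).trans (ENNReal.ofReal_le_ofReal (hsd n))
  refine tendsto_nhds_unique hleft ?_
  have hright : Tendsto (fun n => ∫⁻ ξ in A, upperDensity (occupationMeasure Y 0 (s n)) ξ) atTop
      (𝓝 (∫⁻ ξ in A, upperDensity (occupationMeasure Y 0 t) ξ)) := by
    refine tendsto_lintegral_of_dominated_convergence
      (upperDensity (occupationMeasure Y 0 T)) (fun n => hcont _ (hsT n))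
      (fun n => ae_of_all _ fun ξ =>
        upperDensity_mono (occupationMeasure_mono hY le_rfl (hsT n).2) ξ) ?_
      (ae_of_all _ fun ξ => ?_)
    · rw [← withDensity_apply _ hA, ← (h.hasContinuousDensity_end hT hY).eq_withDensity]
      exact measure_ne_top _ _
    · rw [← ENNReal.tendsto_toReal_iff (fun n => h.upperDensity_ne_top hT hY (hsT n).2 ξ)
        (h.upperDensity_ne_top hT hY ht.2 ξ), tendsto_iff_dist_tendsto_zero]
      refine squeeze_zero (fun _ => dist_nonneg) (fun n => ?_)
        (show Tendsto (fun n => 2 * δ n) atTop (𝓝 0) by simpa using hδ.const_mul 2)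
      refine h.dist_toReal_le hT hY ht (hsT n) ?_ ξ
      rw [abs_sub_comm, abs_of_nonneg (sub_nonneg.2 (hs n).2)]
      exact hsd n
  refine hright.congr fun n => ?_
  conv_rhs => rw [(hsc n).eq_withDensity, withDensity_apply _ hA]

theorem isJointlyContinuousLocalTime (h : HasDyadicDensities T Y δ)
    (hδ : Tendsto δ atTop (𝓝 0)) (hT : 0 < T) (hY : Measurable Y) {θ : ℝ → ℝ}
    (hθ : ∀ᵐ t ∂volume.restrict (Icc 0 T), θ t = Y t) :
    IsJointlyContinuousLocalTime T θ fun ξ t =>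
      (upperDensity (occupationMeasure Y 0 t) ξ).toReal := by
  refine ⟨fun t ht => ⟨fun ξ => ENNReal.toReal_nonneg, fun A hA => ?_⟩,
    h.continuousOn_toReal hδ hT hY⟩
  simp_rw [ENNReal.ofReal_toReal (h.upperDensity_ne_top hT hY ht.2 _)]
  rw [← h.occupationMeasure_apply_eq hδ hT hY ht hA, occupationMeasure_apply hY _ _ hA]
  refine measure_congr ?_
  have h1 := (ae_restrict_iff' measurableSet_Icc).1 hθ
  -- The occupation measure uses `(0, t]` and the local time `[0, t]`; the single time 0 is
  -- negligible.
  filter_upwards [h1, Measure.ae_ne volume (0 : ℝ)] with r hr hr0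
  refine propext ⟨fun hx => ⟨?_, lt_of_le_of_ne hx.1.1 hr0.symm, hx.1.2⟩,
    fun hx => ⟨⟨hx.2.1.le, hx.2.2⟩, ?_⟩⟩
  · have := hr ⟨hx.1.1, hx.1.2.trans ht.2⟩
    exact (show Y r ∈ A from this ▸ hx.2)
  · have := hr ⟨hx.2.1.le, hx.2.2.trans ht.2⟩
    exact (show θ r ∈ A from this.symm ▸ hx.1)

end HasDyadicDensities

end StochasticHeat


namespace StochasticHeat

/-! ### Almost sure existence of the local time -/

lemma exists_density_occupationMeasure {Y : ℝ → ℝ} {a b : ℝ}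
    (h : ∫⁻ v, ‖charFun (occupationMeasure Y a b) (2 * Real.pi * v)‖ₑ ≠ ∞) :
    ∃ f : ℝ → ℝ, Continuous f ∧ (∀ x, 0 ≤ f x) ∧
      (∀ x, f x ≤ (∫⁻ v, ‖charFun (occupationMeasure Y a b) (2 * Real.pi * v)‖ₑ).toReal) ∧
      occupationMeasure Y a b = volume.withDensity fun x => ENNReal.ofReal (f x) := by
  have hm : AEStronglyMeasurable
      (fun v : ℝ => charFun (occupationMeasure Y a b) (2 * Real.pi * v)) volume := by
    have : Continuous fun v : ℝ => charFun (occupationMeasure Y a b) (2 * Real.pi * v) :=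
      continuous_charFun.comp (by fun_prop)
    exact this.aestronglyMeasurable
  have hi : Integrable fun v : ℝ => charFun (occupationMeasure Y a b) (2 * Real.pi * v) :=
    ⟨hm, lt_top_iff_ne_top.2 h⟩
  rw [← integral_norm_eq_lintegral_enorm hm]
  exact exists_continuous_density hi

namespace IsNondeterministic

variable {Ω : Type*} [MeasurableSpace Ω] {P : Measure Ω} {T : ℝ} {S : Set ℝ} {X : ℝ → Ω → ℝ}

/-- The sum of the energies over the dyadic intervals of length `T / 2 ^ n`. -/
noncomputable def dyadicEnergy (X : ℝ → Ω → ℝ) (T : ℝ) (n : ℕ) (ω : Ω) : ℝ≥0∞ :=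
  ∑ k ∈ Finset.range (2 ^ n), occupationEnergy X (T * k / 2 ^ n) (T * (k + 1) / 2 ^ n) ω

lemma measurable_dyadicEnergy (hX : IsNondeterministic P T S X) (n : ℕ) :
    Measurable (dyadicEnergy X T n) :=
  Finset.measurable_fun_sum _ fun _ _ => hX.measurable_occupationEnergy _ _

/-- At level `n` there are `2 ^ n` intervals of expected energy of order `(T / 2 ^ n)^(5/4)`, so the
expectations decay geometrically with ratio `q = 2^(-1/4)`. -/
lemma ae_tsum_dyadicEnergy_ne_top [IsProbabilityMeasure P] (hX : IsNondeterministic P T S X)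
    (hT : 0 < T) : ∀ᵐ ω ∂P, ∑' n, dyadicEnergy X T n ω ≠ ∞ := by
  obtain ⟨C, hC0, hC⟩ := hX.exists_lintegral_occupationEnergy_le
  set q : ℝ := 2 * (1 / 2 : ℝ) ^ (5 / 4 : ℝ)
  have hq0 : 0 ≤ q := by positivity
  have hq1 : q < 1 := by
    have : (1 / 2 : ℝ) ^ (5 / 4 : ℝ) < (1 / 2 : ℝ) ^ (1 : ℝ) :=
      Real.rpow_lt_rpow_of_exponent_gt (by norm_num) (by norm_num) (by norm_num)
    rw [Real.rpow_one] at this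
    linarith
  have hE : ∀ n, ∫⁻ ω, dyadicEnergy X T n ω ∂P ≤
      ENNReal.ofReal (C * T ^ (5 / 4 : ℝ) * q ^ n) := fun n => by
    unfold dyadicEnergy
    rw [lintegral_finsetSum _ fun _ _ => hX.measurable_occupationEnergy _ _]
    have hk : ∀ k ∈ Finset.range (2 ^ n),
        ∫⁻ ω, occupationEnergy X (T * k / 2 ^ n) (T * (k + 1) / 2 ^ n) ω ∂P ≤
          ENNReal.ofReal (C * (T / 2 ^ n) ^ (5 / 4 : ℝ)) := fun k hk => by
      have hk' : ((k : ℝ) + 1) ≤ 2 ^ n := by exact_mod_cast Finset.mem_range.1 hk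
      have := hC (T * k / 2 ^ n) (T * (k + 1) / 2 ^ n) (by positivity) (by gcongr; simp)
        (by rw [div_le_iff₀ (by positivity)]; gcongr)
      rwa [show T * ((k : ℝ) + 1) / 2 ^ n - T * k / 2 ^ n = T / 2 ^ n by ring] at this
    refine (Finset.sum_le_card_nsmul _ _ _ hk).trans (le_of_eq ?_)
    rw [Finset.card_range, ← ENNReal.ofReal_nsmul, nsmul_eq_mul]
    congr 1
    rw [div_eq_mul_one_div, ← one_div_pow, Real.mul_rpow hT.le (by positivity), mul_pow,
      ← Real.rpow_natCast ((1 / 2 : ℝ) ^ (5 / 4 : ℝ)), ← Real.rpow_natCast (1 / 2 : ℝ),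
      ← Real.rpow_mul (by norm_num), ← Real.rpow_mul (by norm_num), mul_comm (n : ℝ)]
    push_cast
    ring
  have hsum : Summable fun n => C * T ^ (5 / 4 : ℝ) * q ^ n :=
    (summable_geometric_of_lt_one hq0 hq1).mul_left _
  have hfin : ∫⁻ ω, ∑' n, dyadicEnergy X T n ω ∂P ≠ ∞ := by
    rw [lintegral_tsum fun n => (hX.measurable_dyadicEnergy n).aemeasurable]
    refine ((ENNReal.tsum_le_tsum hE).trans_lt ?_).ne
    rw [← ENNReal.ofReal_tsum_of_nonneg (fun n => by positivity) hsum]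
    exact ENNReal.ofReal_lt_top
  exact (ae_lt_top (Measurable.tsum fun n => hX.measurable_dyadicEnergy n) hfin).mono
    fun ω hω => hω.ne

/-- The total energy of a level dominates that of each of its intervals, so its square root times
`√π` bounds all their densities at once; it tends to zero as the square root of the term of a
convergent series. -/
lemma exists_hasDyadicDensities {Ω : Type*} {T : ℝ} {X : ℝ → Ω → ℝ} {ω : Ω}
    (hω : ∑' n, dyadicEnergy X T n ω ≠ ∞) :
    ∃ δ : ℕ → ℝ, Tendsto δ atTop (𝓝 0) ∧ HasDyadicDensities T (fun t => X t ω) δ := by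
  set D : ℕ → ℝ≥0∞ := fun n =>
    ENNReal.ofReal Real.pi ^ (1 / 2 : ℝ) * dyadicEnergy X T n ω ^ (1 / 2 : ℝ)
  have hpi : ENNReal.ofReal Real.pi ^ (1 / 2 : ℝ) ≠ ∞ :=
    ENNReal.rpow_ne_top_of_nonneg (by norm_num) ENNReal.ofReal_ne_top
  have hD : ∀ n, D n ≠ ∞ := fun n => ENNReal.mul_ne_top hpi
    (ENNReal.rpow_ne_top_of_nonneg (by norm_num) (ENNReal.ne_top_of_tsum_ne_top hω n))
  have hD0 : Tendsto D atTop (𝓝 0) := by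
    have h1 := ((ENNReal.continuous_rpow_const (y := (1 / 2 : ℝ))).tendsto 0).comp
      (ENNReal.tendsto_atTop_zero_of_tsum_ne_top hω)
    rw [ENNReal.zero_rpow_of_pos (by norm_num)] at h1
    have h2 := ENNReal.Tendsto.const_mul h1 (Or.inr hpi)
    rwa [mul_zero] at h2
  refine ⟨fun n => (D n).toReal, ?_, fun n k hk => ?_⟩
  · exact (ENNReal.tendsto_toReal ENNReal.zero_ne_top).comp hD0
  have hle : ∫⁻ v, ‖charFun (occupationMeasure (fun t => X t ω) (T * k / 2 ^ n)
      (T * (k + 1) / 2 ^ n)) (2 * Real.pi * v)‖ₑ ≤ D n := by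
    refine (lintegral_enorm_le_of_weighted ?_).trans ?_
    · exact ((measurable_charFun).comp (by fun_prop : Measurable fun v : ℝ => 2 * Real.pi * v))
    · refine mul_le_mul_right (ENNReal.rpow_le_rpow ?_ (by norm_num)) _
      exact Finset.single_le_sum (f := fun k : ℕ =>
        occupationEnergy X (T * k / 2 ^ n) (T * (k + 1) / 2 ^ n) ω)
        (fun _ _ => zero_le) (Finset.mem_range.2 hk)
  obtain ⟨f, hf, hf0, hfD, hfe⟩ := exists_density_occupationMeasure
    (hle.trans_lt (hD n).lt_top).ne
  exact ⟨f, hf, hf0, fun x => (hfD x).trans (ENNReal.toReal_mono (hD n) hle), hfe⟩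

theorem ae_exists_isJointlyContinuousLocalTime [IsProbabilityMeasure P]
    (hX : IsNondeterministic P T S X) (hT : 0 < T) {θ : ℝ → Ω → ℝ}
    (hθ : ∀ᵐ ω ∂P, ∀ᵐ t ∂volume.restrict (Icc 0 T), θ t ω = X t ω) :
    ∀ᵐ ω ∂P, ∃ L, IsJointlyContinuousLocalTime T (fun t => θ t ω) L := by
  filter_upwards [hX.ae_tsum_dyadicEnergy_ne_top hT, hθ] with ω hω hθω
  obtain ⟨δ, hδ, h⟩ := exists_hasDyadicDensities hω
  exact ⟨_, h.isJointlyContinuousLocalTime hδ hT (hX.measurable_path ω) hθω⟩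

end IsNondeterministic

end StochasticHeat

/-! ### Conclusion: existence and regularity combined -/

theorem theorem3p3 {Ω : Type*} [MeasurableSpace Ω] (P : Measure Ω) [IsProbabilityMeasure P]
    (W : ℝ≥0 × StochasticHeat.BoundedBorel → Ω → ℝ) (hW : StochasticHeat.IsWhiteNoise P W)
    (T : ℝ) (hT : 1 ≤ T) (u : ℝ → ℝ → Ω → ℝ) (hu : StochasticHeat.IsMildSolution P W T u)
    (x : ℝ)
    (hmeas : AEMeasurable (fun q : ℝ × Ω => u q.1 x q.2) ((volume.restrict (Icc 0 T)).prod P))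
    (lam p ξ : ℝ) (hlam : 0 < lam) (hp : 1 / lam < p) :
    ∀ᵐ ω ∂P,
      (∃ L : ℝ → ℝ → ℝ,
        StochasticHeat.IsJointlyContinuousLocalTime T (fun t => u t x ω) L) ∧
      ∀ L : ℝ → ℝ → ℝ,
        StochasticHeat.IsJointlyContinuousLocalTime T (fun t => u t x ω) L →
        StochasticHeat.MemModularBesov (StochasticHeat.logModulus (3 / 4) lam) p (Icc 0 1)
          (fun t => L ξ t) := by
  obtain ⟨S, X, hX, hθ⟩ := hu.exists_isNondeterministic hW x hmeas
  filter_upwards [hX.ae_exists_isJointlyContinuousLocalTime (by linarith) hθ,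
    hX.ae_memModularBesov hT hθ hlam hp ξ] with ω h1 h2
  exact ⟨h1, h2⟩
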